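/- A stabilizer ZX-diagram is a finite open graph, considered up to topology (nodes may be moved, wires bent, stretched and subdivided, and only which ends are joined matters; node-free loops are allowed), whose nodes are: green and red nodes with any finite number of legs (possibly zero) and a phase in $\{0,\pi/2,\pi,-\pi/2\}$, and Hadamard nodes with exactly two legs. Diagrams of the scaled calculus may also contain star nodes, which have no legs. A diagram is a scalar diagram if it has no inputs and no outputs, i.e. no open wires. Write $\langle\alpha|\beta\rangle$ for the scalar diagram consisting of a one-legged green node of phase $\alpha$ and a one-legged red node of phase $\beta$ joined by a wire, and $g=\langle 0|0\rangle$. Rewriting means applying finitely many of the following rules, in either direction and to arbitrary subdiagrams; each rule is also used with the colours green and red exchanged. Rules of both calculi: (spider) two nodes of the same colour joined by a wire merge and their phases add modulo $2\pi$; (loop) a wire from a green or red node to itself may be removed; (cup) a phase-$0$ node with two legs is a plain wire; (colour change) a node equals the node of the other colour with the same phase and number of legs, with a Hadamard node on each leg; ($\pi$-copy) a red node of phase $\pi$ with two legs, placed on one leg of a green phase-$0$ node, may be replaced by such red $\pi$-nodes on all the other legs. Further rules of the scalar-free calculus, with $L\to R$ written for replacing $L$ by $R$: (bialgebra) $L$: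 two three-legged green and two three-legged red nodes, all of phase $0$, each having one open leg and each green node being joined to each red node by one wire; $R$: a three-legged red phase-$0$ node joined by one wire to a three-legged green phase-$0$ node, where the red node carries the two open wires formerly at the green nodes and the green node carries the two formerly at the red nodes; (copy) $L$: a one-legged red phase-$0$ node joined to a three-legged green phase-$0$ node; $R$: two separate one-legged red phase-$0$ nodes; ($\pi$-commutation) $L$: on a wire, a red $\pi$-node followed by a green $\alpha$-node; $R$: on that wire, a green $(-\alpha)$-node followed by a red $\pi$-node; (Euler) $L$: a Hadamard node; $R$: on that wire, a green, a red and a green node, each of phase $\pi/2$. The scalar-free calculus is taken here without the convention that non-zero scalars may be dropped, so that the scalars produced are kept. In the scaled calculus these four rules are replaced by their scaled versions $$g\,L\to R,\qquad g\,L\to R,\qquad g\,L\to\langle\alpha|\pi\rangle\,R,\qquad g\,g\,L\to\langle-\tfrac{\pi}{2}|-\tfrac{\pi}{2}\rangle\,R$$ respectively, and the star rule is added: a star node together with a green phase-$0$ node without legs may be replaced by the empty diagram. Corollary. In the scalar-free calculus as well as in the scaled calculus, every stabilizer scalar diagram can be rewritten into a diagram that is a disjoint union of finitely many mutually disconnected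 scalar diagrams, each of which contains at most two nodes. -/

import Mathlib

namespace ZX

/-- The two calculi: the one with the scalar-free rewrite rules, and the one with the correctly
scaled rewrite rules and the additional star node. -/
inductive Calculus
  | scalarFree
  | scaled

/-- The two colours of phase-carrying nodes. -/
inductive Colour
  | green
  | red

/-- The other colour. -/
def Colour.swap : Colour → Colour
  | .green => .red
  | .red => .green

/-- The building blocks of stabilizer diagrams. Natural numbers name the points at which the ends
of building blocks are attached to each other. Only the topology matters, so that the ends of a
node are neither ordered nor divided into inputs and outputs.

* `spider c k A`: a node of colour `c` with phase `k * (π / 2)`, one leg for each member of `A`;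
* `had s(a, b)`: a Hadamard node with its two legs ending at `a` and `b`;
* `star`: the star node (scaled calculus only);
* `edge s(a, b)`: a piece of wire from `a` to `b`, which is not a node; `edge s(a, a)` is the
  node-free loop. -/
inductive Element (κ : Calculus)
  | spider (c : Colour) (phase : ZMod 4) (legs : Multiset ℕ)
  | had (ends : Sym2 ℕ)
  | star (h : κ = Calculus.scaled)
  | edge (ends : Sym2 ℕ)

namespace Element

variable {κ : Calculus}

/-- The end points of a building block, with multiplicity. -/
def points : Element κ → Multiset ℕ
  | spider _ _ A => A
  | had e => e.toMultiset
  | star _ => 0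
  | edge e => e.toMultiset

/-- Renaming of points. -/
def rename (f : ℕ → ℕ) : Element κ → Element κ
  | spider c k A => spider c k (A.map f)
  | had e => had (e.map f)
  | star h => star h
  | edge e => edge (e.map f)

/-- The number of nodes: every building block is one node, except that wires are not nodes. -/
def nodes : Element κ → ℕ
  | edge _ => 0
  | _ => 1

end Element

/-- A diagram is a finite collection of building blocks. Two ends with the same name are joined;
an end whose name occurs only once is an input or output of the diagram. -/
abbrev Diagram (κ : Calculus) := Multiset (Element κ)

namespace Diagram

variable {κ : Calculus}

/-- All end points in a diagram, with multiplicity. -/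
def points (D : Diagram κ) : Multiset ℕ := D.bind Element.points

/-- The number of nodes of a diagram. -/
def nodeCount (D : Diagram κ) : ℕ := (D.map Element.nodes).sum

/-- At most two ends meet at any point. -/
def WellFormed (D : Diagram κ) : Prop := ∀ p, D.points.count p ≤ 2

/-- A scalar diagram has neither inputs nor outputs: at every point that occurs in the diagram,
exactly two ends meet. -/
def IsScalar (D : Diagram κ) : Prop := ∀ p, D.points.count p = 0 ∨ D.points.count p = 2

/-- The diagram consists of disconnected segments (scalar diagrams with no point in common)
that contain at most two nodes each. -/
def IsDecomposed (D : Diagram κ) : Prop :=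
  ∃ segments : List (Diagram κ),
    D = segments.sum ∧
    (∀ S ∈ segments, S.IsScalar ∧ S.nodeCount ≤ 2) ∧
    segments.Pairwise (fun S T => Disjoint S.points T.points)

end Diagram

open Element

/-- The scalar diagram of two single-leg nodes of different colours, `c` with phase `j * (π / 2)`
and the other colour with phase `k * (π / 2)`, joined at the point `v`. -/
def innerProd (κ : Calculus) (c : Colour) (j k : ZMod 4) (v : ℕ) : Diagram κ :=
  {spider c j {v}, spider c.swap k {v}}

/-- The rewrite rules. Since ends are not divided into inputs and outputs, each rule stands
also for its upside-down version; the colour `c` covers the colour-swapped versions. Phases are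
multiples of `π / 2`, so that `π` is `2` and `-π / 2` is `3`. -/
inductive Rule : (κ : Calculus) → Diagram κ → Diagram κ → Prop
  /-- Two nodes of the same colour that are connected by an edge merge; the phases add. -/
  | spider (κ : Calculus) (c : Colour) (j k : ZMod 4) (x : ℕ) (A B : Multiset ℕ) :
      Rule κ {spider c j (x ::ₘ A), spider c k (x ::ₘ B)} {spider c (j + k) (A + B)}
  /-- Self-loops can be removed. -/
  | loop (κ : Calculus) (c : Colour) (j : ZMod 4) (x : ℕ) (A : Multiset ℕ) :
      Rule κ {spider c j (x ::ₘ x ::ₘ A)} {spider c j A}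
  /-- A phase-free node with two legs is a wire. -/
  | cup (κ : Calculus) (c : Colour) (a b : ℕ) :
      Rule κ {spider c 0 {a, b}} {edge s(a, b)}
  /-- Colour change: a node is the node of the other colour with a Hadamard node on each leg. -/
  | colour (κ : Calculus) (c : Colour) (j : ZMod 4) (P : Multiset (ℕ × ℕ)) :
      Rule κ {spider c j (P.map Prod.fst)}
        ({spider c.swap j (P.map Prod.snd)} + P.map (fun p => had s(p.1, p.2)))
  /-- A `π` phase shift is copied by a phase-free node of the other colour. -/
  | piCopy (κ : Calculus) (c : Colour) (a x : ℕ) (P : Multiset (ℕ × ℕ)) :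
      Rule κ {spider c.swap 2 {a, x}, spider c 0 (x ::ₘ P.map Prod.fst)}
        ({spider c 0 (a ::ₘ P.map Prod.snd)} +
          P.map (fun p => spider c.swap 2 {p.2, p.1}))
  /-- The bialgebra rule, scalar-free. -/
  | bialgebra (c : Colour) (a b p q w x y z u : ℕ) :
      Rule .scalarFree
        {spider c 0 {a, w, x}, spider c 0 {b, y, z},
          spider c.swap 0 {w, y, p}, spider c.swap 0 {x, z, q}}
        {spider c.swap 0 {a, b, u}, spider c 0 {u, p, q}}
  /-- The bialgebra rule, scaled. -/
  | bialgebraScaled (c : Colour) (a b p q w x y z u v : ℕ) :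
      Rule .scaled
        (innerProd .scaled c 0 0 v +
          {spider c 0 {a, w, x}, spider c 0 {b, y, z},
            spider c.swap 0 {w, y, p}, spider c.swap 0 {x, z, q}})
        {spider c.swap 0 {a, b, u}, spider c 0 {u, p, q}}
  /-- The copy rule, scalar-free. -/
  | copy (c : Colour) (a b x : ℕ) :
      Rule .scalarFree
        {spider c.swap 0 {x}, spider c 0 {x, a, b}}
        {spider c.swap 0 {a}, spider c.swap 0 {b}}
  /-- The copy rule, scaled. -/
  | copyScaled (c : Colour) (a b x v : ℕ) :
      Rule .scaled
        (innerProd .scaled c 0 0 v + {spider c.swap 0 {x}, spider c 0 {x, a, b}})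
        {spider c.swap 0 {a}, spider c.swap 0 {b}}
  /-- The `π`-commutation rule, scalar-free. -/
  | piComm (c : Colour) (j : ZMod 4) (a b x y : ℕ) :
      Rule .scalarFree
        {spider c.swap 2 {a, x}, spider c j {x, b}}
        {spider c (-j) {a, y}, spider c.swap 2 {y, b}}
  /-- The `π`-commutation rule, scaled. -/
  | piCommScaled (c : Colour) (j : ZMod 4) (a b x y v w : ℕ) :
      Rule .scaled
        (innerProd .scaled c 0 0 v + {spider c.swap 2 {a, x}, spider c j {x, b}})
        (innerProd .scaled c j 2 w + {spider c (-j) {a, y}, spider c.swap 2 {y, b}})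
  /-- The Euler decomposition of the Hadamard node, scalar-free. -/
  | euler (c : Colour) (a b x y : ℕ) :
      Rule .scalarFree
        {had s(a, b)}
        {spider c 1 {a, x}, spider c.swap 1 {x, y}, spider c 1 {y, b}}
  /-- The Euler decomposition of the Hadamard node, scaled. -/
  | eulerScaled (c : Colour) (a b x y v v' w : ℕ) :
      Rule .scaled
        (innerProd .scaled c 0 0 v + innerProd .scaled c 0 0 v' + {had s(a, b)})
        (innerProd .scaled c 3 3 w +
          {spider c 1 {a, x}, spider c.swap 1 {x, y}, spider c 1 {y, b}})
  /-- The star rule: the star node is the inverse of the phase-free node without legs. -/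
  | star (c : Colour) :
      Rule .scaled {star rfl, spider c 0 0} 0

/-- A single rewrite step. Well-formedness of both sides makes sure that the rest `C` of the
diagram meets the rewritten part only in inputs and outputs of the latter. -/
inductive Step (κ : Calculus) : Diagram κ → Diagram κ → Prop
  /-- A rewrite rule is applied to a subdiagram. -/
  | rule (L R C : Diagram κ) (h : Rule κ L R)
      (hL : Diagram.WellFormed (L + C)) (hR : Diagram.WellFormed (R + C)) :
      Step κ (L + C) (R + C)
  /-- Only the topology matters: a wire that continues another end is absorbed by it. -/
  | topology (a b : ℕ) (D : Diagram κ) (hb : b ∈ D.points)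
      (hD : Diagram.WellFormed ({edge s(a, b)} + D)) :
      Step κ ({edge s(a, b)} + D) (D.map (Element.rename (fun p => if p = b then a else p)))

/-- `D` can be rewritten into `D'`: finitely many rewrite steps, each in either direction. -/
def Rewrites (κ : Calculus) (D D' : Diagram κ) : Prop := Relation.EqvGen (Step κ) D D'

end ZX

/-!
A stabilizer diagram is treated as a sum over paths. Each set of ends joined by phase-free green
nodes is a variable with values in `{0, 1}`; a one-legged green node is a phase of a variable, a
Hadamard node a sign that depends on two variables, and a red node a constraint on the parity of its
variables. By colour change, a variable that occurs only in a phase and in Hadamard nodes is the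
same as a red node on the variables at the other ends of these Hadamard nodes.

The variables are eliminated one by one, by turning a variable into such a red node. If its phase is
`0` or `π`, the constraint is solved for one variable, which is substituted everywhere else. If its
phase is `π/2` or `-π/2`, it depends only on the parity of its variables, and the phase of a
parity is a product of phases of the variables and of signs of pairs of them. Every step splits off
only pieces with at most two nodes.
-/

namespace ZX

open Element Diagram

section Contexts

variable {κ : Calculus}

namespace Diagram

@[simp] theorem points_zero : (0 : Diagram κ).points = 0 := rfl

@[simp] theorem points_add (D E : Diagram κ) : (D + E).points = D.points + E.points :=
  Multiset.add_bind D E Element.points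

@[simp] theorem points_singleton (e : Element κ) : points ({e} : Diagram κ) = e.points :=
  Multiset.singleton_bind e Element.points

theorem points_list_sum (l : List (Diagram κ)) : l.sum.points = (l.map points).sum := by
  induction l <;> simp [*]

theorem IsScalar.wellFormed {D : Diagram κ} (h : D.IsScalar) : D.WellFormed := fun p => by
  rcases h p with h | h <;> omega

theorem IsScalar.disjoint_of_add {S D : Diagram κ} (hS : S.IsScalar) (h : (S + D).IsScalar) :
    Disjoint S.points D.points := by
  rw [Multiset.disjoint_left]
  intro p hpS hpD
  have hSp := hS p
  have hp := h p
  rw [points_add, Multiset.count_add] at hp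
  rw [← Multiset.one_le_count_iff_mem] at hpS hpD
  omega

theorem IsScalar.add {S T : Diagram κ} (hS : S.IsScalar) (hT : T.IsScalar)
    (h : Disjoint S.points T.points) : (S + T).IsScalar := by
  intro p
  rw [points_add, Multiset.count_add]
  by_cases hp : p ∈ S.points
  · rw [Multiset.count_eq_zero.2 (Multiset.disjoint_left.1 h hp), add_zero]
    exact hS p
  · rw [Multiset.count_eq_zero.2 hp, zero_add]
    exact hT p

theorem IsScalar.add_of_wellFormed {S T D : Diagram κ} (hS : S.IsScalar) (hT : T.IsScalar)
    (h : (S + T + D).WellFormed) : (S + T).IsScalar := by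
  intro p
  have hSp := hS p
  have hTp := hT p
  have hp := h p
  simp only [points_add, Multiset.count_add] at hp ⊢
  omega

theorem IsDecomposed.isScalar {D : Diagram κ} (h : D.IsDecomposed) : D.IsScalar := by
  obtain ⟨l, rfl, hl, hd⟩ := h
  induction l with
  | nil => exact fun _ => .inl rfl
  | cons S l ih =>
    rw [List.pairwise_cons] at hd
    rw [List.forall_mem_cons] at hl
    rw [List.sum_cons]
    refine hl.1.1.add (ih hl.2 hd.2) ?_
    simpa [points_list_sum, Multiset.disjoint_list_sum_right] using hd.1

theorem IsDecomposed.add_segment {D S : Diagram κ} (hD : D.IsDecomposed) (hS : S.IsScalar)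
    (hn : S.nodeCount ≤ 2) (h : (S + D).IsScalar) : (S + D).IsDecomposed := by
  have hd := hS.disjoint_of_add h
  obtain ⟨l, rfl, hl, hp⟩ := hD
  refine ⟨S :: l, rfl, List.forall_mem_cons.2 ⟨⟨hS, hn⟩, hl⟩, List.pairwise_cons.2 ⟨?_, hp⟩⟩
  simpa [points_list_sum, Multiset.disjoint_list_sum_right] using hd

end Diagram

theorem Rewrites.refl (D : Diagram κ) : Rewrites κ D D := Relation.EqvGen.refl D

theorem Rewrites.symm {D E : Diagram κ} (h : Rewrites κ D E) : Rewrites κ E D :=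
  Relation.EqvGen.symm _ _ h

theorem Rewrites.trans {D E F : Diagram κ} (h : Rewrites κ D E) (h' : Rewrites κ E F) :
    Rewrites κ D F :=
  Relation.EqvGen.trans _ _ _ h h'

theorem Rewrites.of_rule {L R C : Diagram κ} (h : Rule κ L R ∨ Rule κ R L)
    (hL : (L + C).WellFormed) (hR : (R + C).WellFormed) : Rewrites κ (L + C) (R + C) :=
  h.elim (fun h => .rel _ _ (.rule L R C h hL hR)) fun h => .symm (.rel _ _ (.rule R L C h hR hL))

/-- The property of diagrams that the elimination of variables establishes: in the presence of any
decomposed diagram, `D` can be rewritten into a decomposed diagram. The decomposed diagram collects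
the segments that have been split off. -/
def Reducible (κ : Calculus) (D : Diagram κ) : Prop :=
  ∀ S : Diagram κ, S.IsDecomposed → (S + D).IsScalar →
    ∃ D' : Diagram κ, Rewrites κ (S + D) D' ∧ D'.IsDecomposed

theorem Reducible.exists_isDecomposed {D : Diagram κ} (h : Reducible κ D) (hD : D.IsScalar) :
    ∃ D' : Diagram κ, Rewrites κ D D' ∧ D'.IsDecomposed := by
  simpa using h 0 ⟨[], rfl, by simp, .nil⟩ (by simpa using hD)

theorem Reducible.zero : Reducible κ 0 := fun S hS _ =>
  ⟨S, by simpa using Rewrites.refl S, hS⟩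

theorem Reducible.add_segment {S D : Diagram κ} (hD : Reducible κ D) (hS : S.IsScalar)
    (hn : S.nodeCount ≤ 2) : Reducible κ (S + D) := by
  intro T hT h
  rw [← add_assoc, add_comm T S] at h ⊢
  exact hD _ (hT.add_segment hS hn (hS.add_of_wellFormed hT.isScalar h.wellFormed)) h

section InContext

variable {M : Type*} [AddCommMonoid M] {P : M → Prop}

/-- Placed next to anything that has the property `Q`, the diagram `L` has the property `P`. -/
def InContext (P : M → Prop) (L : M) (Q : M → Prop) : Prop := ∀ C, Q C → P (L + C)

/-- `L` may be replaced by `R` in a goal of the form `P (L + C)`. -/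
def ReducesTo (P : M → Prop) (L R : M) : Prop := InContext P L fun C => P (R + C)

notation:50 L:51 "⇝[" κ "]" R:51 => ReducesTo (Reducible κ) L R

theorem ReducesTo.of_eq {L R : M} (h : L = R) : ReducesTo P L R := fun _ hC => h ▸ hC

@[refl] theorem ReducesTo.refl (L : M) : ReducesTo P L L := .of_eq rfl

theorem ReducesTo.trans_inContext {L R : M} {Q : M → Prop} (h : ReducesTo P L R)
    (h' : InContext P R Q) : InContext P L Q := fun C hC => h C (h' C hC)

theorem ReducesTo.trans {L R T : M} (h : ReducesTo P L R) (h' : ReducesTo P R T) :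
    ReducesTo P L T :=
  h.trans_inContext h'

instance : Trans (ReducesTo P) (InContext P) (InContext P) := ⟨ReducesTo.trans_inContext⟩

instance : Trans (ReducesTo P) (ReducesTo P) (ReducesTo P) := ⟨ReducesTo.trans⟩

@[gcongr] theorem ReducesTo.add {L R L' R' : M} (h : ReducesTo P L R) (h' : ReducesTo P L' R') :
    ReducesTo P (L + L') (R + R') := fun C hC => by
  rw [add_assoc]
  refine h _ (?_ : P (R + (L' + C)))
  rw [add_left_comm]
  refine h' _ (?_ : P (R' + (R + C)))
  rwa [add_left_comm, ← add_assoc]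

theorem ReducesTo.zero {L : M} (h : ∀ C, P C → P (L + C)) : ReducesTo P L 0 := fun C hC =>
  h C (by simpa using hC)

theorem ReducesTo.elim {L R : M} (h : ReducesTo P L R) (hR : P R) : P L := by
  simpa using h 0 (by simpa using hR)

theorem InContext.bind {ι : Type*} {p : ι → Prop} {L K : M} {R : ι → M} {Q : M → Prop}
    (h : InContext P L fun C => ∀ x, p x → P (R x + C))
    (h' : ∀ x, p x → InContext P (R x + K) Q) : InContext P (L + K) Q := fun C hC => by
  rw [add_assoc]
  refine h _ fun x hx => ?_
  rw [← add_assoc]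
  exact h' x hx C hC

end InContext

/-- The name of the variable that a point belongs to. Every variable has infinitely many points, so
that fresh ones are always available. -/
def var (p : ℕ) : ℕ := p.unpair.2

theorem exists_fresh {n : ℕ} (F : Finset ℕ) (v : Fin n → ℕ) :
    ∃ x : Fin n → ℕ, x.Injective ∧ (∀ i, var (x i) = v i) ∧ ∀ i, x i ∉ F := by
  refine ⟨fun i => Nat.pair (F.sup id + 1 + i) (v i), fun i j h => ?_, fun i => by simp [var],
    fun i hi => ?_⟩
  · rw [Nat.pair_eq_pair] at h
    omega
  · have := Finset.le_sup (f := id) hi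
    have := Nat.left_le_pair (F.sup id + 1 + i) (v i)
    simp only [id] at *
    omega

theorem sum_singleton_eq_map {ι α : Type*} [Fintype ι] (x : ι → α) :
    (∑ i, {x i} : Multiset α) = Finset.univ.val.map x := by
  rw [← Multiset.sum_map_singleton (Finset.univ.val.map x), Multiset.map_map]
  rfl

/-- `I` consists of the internal points of `L`, and `x` of those of `R x`, which can be chosen fresh
and in any given variables `v`. -/
theorem Reducible.of_rewrites {n : ℕ} (v : Fin n → ℕ) (I : Multiset ℕ) {L C : Diagram κ}
    {R : (Fin n → ℕ) → Diagram κ}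
    (h : ∀ x C, (L + C).IsScalar → (R x + C).IsScalar → Rewrites κ (L + C) (R x + C))
    (hR : ∀ x, (R x).points + (I + I) = L.points + (∑ i, {x i} + ∑ i, {x i}))
    (hC : ∀ x, (∀ i, var (x i) = v i) → Reducible κ (R x + C)) : Reducible κ (L + C) := by
  intro S hS hSL
  obtain ⟨x, hx, hv, hF⟩ := exists_fresh (S + (L + C)).points.toFinset v
  have hSR : (S + (R x + C)).IsScalar := fun p => by
    have hSp := hSL p
    have hRp := congrArg (Multiset.count p) (hR x)
    have hxp : (∑ i, {x i} : Multiset ℕ).count p = 0 ∨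
        (∑ i, {x i} : Multiset ℕ).count p = 1 ∧ (S + (L + C)).points.count p = 0 := by
      rw [sum_singleton_eq_map]
      by_cases hp : p ∈ Finset.univ.val.map x
      · refine .inr ⟨Multiset.count_eq_one_of_mem (Finset.univ.nodup.map hx) hp, ?_⟩
        obtain ⟨i, -, rfl⟩ := Multiset.mem_map.1 hp
        simpa using hF i
      · exact .inl (Multiset.count_eq_zero.2 hp)
    simp only [points_add, Multiset.count_add] at *
    omega
  obtain ⟨D, hD, hD'⟩ := hC x hv S hS hSR
  refine ⟨D, .trans ?_ hD, hD'⟩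
  rw [add_left_comm S] at hSL hSR ⊢
  rw [add_left_comm S]
  exact h x (S + C) hSL hSR

theorem Reducible.of_rule {n : ℕ} (v : Fin n → ℕ) (I : Multiset ℕ) {L C : Diagram κ}
    {R : (Fin n → ℕ) → Diagram κ} (h : ∀ x, Rule κ L (R x) ∨ Rule κ (R x) L)
    (hR : ∀ x, (R x).points + (I + I) = L.points + (∑ i, {x i} + ∑ i, {x i}))
    (hC : ∀ x, (∀ i, var (x i) = v i) → Reducible κ (R x + C)) : Reducible κ (L + C) :=
  .of_rewrites v I (fun x _ hL hR => .of_rule (h x) hL.wellFormed hR.wellFormed) hR hC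

theorem ReducesTo.of_rule (I : Multiset ℕ) {L R : Diagram κ} (h : Rule κ L R ∨ Rule κ R L)
    (hR : R.points + (I + I) = L.points) : L ⇝[κ] R := fun _ hC =>
  .of_rule (R := fun _ => R) ![] I (fun _ => h) (fun _ => by simpa using hR) fun _ _ => hC

end Contexts

section Rules

variable {κ : Calculus} {c : Colour} {j k : ZMod 4} {a b p q r s t u w x y z : ℕ} {A B : Multiset ℕ}
  {K : Diagram κ} {Q : Diagram κ → Prop}

theorem Colour.swap_swap (c : Colour) : c.swap.swap = c := by cases c <;> rfl

@[simp] theorem points_had (a b : ℕ) : (had s(a, b) : Element κ).points = {a} + {b} := rfl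

@[simp] theorem points_edge (a b : ℕ) : (edge s(a, b) : Element κ).points = {a} + {b} := rfl

@[simp] theorem points_spider (c : Colour) (k : ZMod 4) (A : Multiset ℕ) :
    (spider c k A : Element κ).points = A := rfl

theorem innerProd_eq (v : ℕ) :
    innerProd κ c j k v = {spider c j {v}} + {spider c.swap k {v}} := rfl

theorem had_comm (a b : ℕ) : (had s(a, b) : Element κ) = had s(b, a) := by rw [Sym2.eq_swap]

/- Legs are written as sums of singletons, so that `ac_rfl` identifies diagrams up to the order of
nodes and legs. -/

theorem ReducesTo.merge (x : ℕ) :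
    {spider c j ({x} + A)} + {spider c k ({x} + B)} ⇝[κ] {spider c (j + k) (A + B)} :=
  .of_rule {x} (.inl (.spider κ c j k x A B)) (by simp [-Multiset.singleton_add]; abel)

theorem ReducesTo.merge_zero (x : ℕ) :
    {spider c k ({x} + A)} + {spider c 0 ({x} + B)} ⇝[κ] {spider c k (A + B)} := by
  simpa only [add_zero] using merge (k := 0) x

theorem InContext.split (v : ℕ)
    (h : ∀ x, var x = v → InContext (Reducible κ)
      ({spider c j ({x} + A)} + {spider c k ({x} + B)} + K) Q) :
    InContext (Reducible κ) ({spider c (j + k) (A + B)} + K) Q :=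
  .bind (p := fun x : Fin 1 → ℕ => ∀ i, var (x i) = ![v] i)
    (fun _ => .of_rule ![v] 0 (fun x => .inr (.spider κ c j k (x 0) A B))
      fun x => by simp [← Multiset.singleton_add]; abel)
    fun x hx => h (x 0) (hx 0)

theorem InContext.split_zero (v : ℕ)
    (h : ∀ x, var x = v → InContext (Reducible κ)
      ({spider c k ({x} + A)} + {spider c 0 ({x} + B)} + K) Q) :
    InContext (Reducible κ) ({spider c k (A + B)} + K) Q := by
  simpa only [add_zero] using split v h

theorem ReducesTo.merge_state (x : ℕ) :
    {spider c k ({x} + A)} + {spider c 0 {x}} ⇝[κ] {spider c k A} := by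
  simpa only [add_zero] using merge_zero (B := 0) x

theorem InContext.split_state (v : ℕ)
    (h : ∀ x, var x = v → InContext (Reducible κ)
      ({spider c k ({x} + A)} + {spider c 0 {x}} + K) Q) :
    InContext (Reducible κ) ({spider c k A} + K) Q := by
  simpa only [add_zero] using split_zero (B := 0) v h

theorem ReducesTo.loop (x : ℕ) : {spider c j ({x} + {x} + A)} ⇝[κ] {spider c j A} :=
  .of_rule {x} (.inl (by rw [add_assoc]; exact .loop κ c j x A))
    (by simp [-Multiset.singleton_add]; abel)

theorem ReducesTo.cup (c : Colour) : {spider c 0 ({a} + {b})} ⇝[κ] {edge s(a, b)} :=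
  .of_rule 0 (.inl (.cup κ c a b)) (by simp)

theorem ReducesTo.edge (c : Colour) : {edge s(a, b)} ⇝[κ] {spider c 0 ({a} + {b})} :=
  .of_rule 0 (.inr (.cup κ c a b)) (by simp)

theorem ReducesTo.recolour (c c' : Colour) :
    {spider c 0 ({a} + {b})} ⇝[κ] {spider c' 0 ({a} + {b})} :=
  (ReducesTo.cup c).trans (.edge c')

/-- The Hadamard nodes that join the points of each of the given pairs, as they occur in the colour
change rule. -/
def hads (κ : Calculus) (P : Multiset (ℕ × ℕ)) : Diagram κ := P.map fun p => had s(p.1, p.2)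

@[simp] theorem hads_add (P Q : Multiset (ℕ × ℕ)) : hads κ (P + Q) = hads κ P + hads κ Q :=
  Multiset.map_add _ _ _

@[simp] theorem hads_singleton (p : ℕ × ℕ) : hads κ {p} = {had s(p.1, p.2)} := rfl

@[simp] theorem points_hads (P : Multiset (ℕ × ℕ)) :
    (hads κ P).points = P.map Prod.fst + P.map Prod.snd := by
  induction P using Multiset.induction with
  | empty => rfl
  | cons p P ih =>
    simp only [← Multiset.singleton_add, hads_add, points_add, ih, hads_singleton,
      points_singleton, points_had, Multiset.map_add, Multiset.map_singleton]
    abel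

theorem InContext.colour (v : ℕ)
    (h : ∀ P : Multiset (ℕ × ℕ), P.map Prod.fst = A → (∀ p ∈ P, var p.2 = v) →
      InContext (Reducible κ) ({spider c.swap k (P.map Prod.snd)} + hads κ P + K) Q) :
    InContext (Reducible κ) ({spider c k A} + K) Q := by
  obtain ⟨l, rfl⟩ := A.exists_rep
  let P (x : Fin l.length → ℕ) := Finset.univ.val.map fun i => (l[i], x i)
  have hfst x : (P x).map Prod.fst = l := by
    rw [Multiset.map_map]
    simp
  have hsnd x : (P x).map Prod.snd = Finset.univ.val.map x := Multiset.map_map _ _ _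
  refine .bind (p := fun x : Fin l.length → ℕ => ∀ i, var (x i) = v)
    (fun _ => .of_rule (fun _ => v) 0 (fun x => .inl ?_)
      (R := fun x => {spider c.swap k ((P x).map Prod.snd)} + hads κ (P x)) fun x => ?_)
    fun x hx => h (P x) (hfst x) (by simpa [P] using hx)
  · have := Rule.colour κ c k (P x)
    rwa [hfst] at this
  · simp only [points_add, points_singleton, points_spider, points_hads, hfst, hsnd,
      sum_singleton_eq_map]
    change _ = (l : Multiset ℕ) + _
    abel

theorem ReducesTo.uncolour (P : Multiset (ℕ × ℕ)) :
    {spider c.swap k (P.map Prod.snd)} + hads κ P ⇝[κ] {spider c k (P.map Prod.fst)} :=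
  .of_rule (P.map Prod.snd) (.inr (.colour κ c k P)) (by simp [-Multiset.singleton_add]; abel)

theorem ReducesTo.innerProd (v : ℕ) : innerProd κ c j k v ⇝[κ] 0 := .zero fun C hC => by
  refine hC.add_segment (fun p => ?_) (by simp [ZX.innerProd, nodeCount, nodes])
  simp only [innerProd_eq, points_add, points_singleton, points_spider, Multiset.count_add]
  rcases Nat.le_one_iff_eq_zero_or_eq_one.1
    (Multiset.nodup_iff_count_le_one.1 (Multiset.nodup_singleton v) p) with h | h <;> simp [h]

theorem ReducesTo.legless {e : Element κ} (he : e.points = 0) : {e} ⇝[κ] 0 := .zero fun C hC => by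
  refine hC.add_segment (fun p => by simp [he]) ?_
  cases e <;> simp [nodeCount, nodes]

theorem InContext.innerProd_add {L : Diagram κ} (v : ℕ) (h : InContext (Reducible κ) (L + K) Q) :
    InContext (Reducible κ) (ZX.innerProd κ c j k v + L + K) Q := by
  rw [add_assoc]
  calc _ ⇝[κ] 0 + (L + K) := by gcongr; exact .innerProd v
    _ = L + K := zero_add _
    InContext (Reducible κ) _ Q := h

theorem Element.rename_eq_self {f : ℕ → ℕ} {e : Element κ} (h : ∀ p ∈ e.points, f p = p) :
    e.rename f = e := by
  have hsym (s : Sym2 ℕ) (h : ∀ p ∈ s.toMultiset, f p = p) : s.map f = s :=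
    (Sym2.map_congr (g := id) (by simpa using h)).trans (congrFun Sym2.map_id s)
  cases e with
  | spider c k A => exact congrArg (spider c k) ((Multiset.map_congr rfl h).trans A.map_id')
  | had s => exact congrArg had (hsym s h)
  | star h => rfl
  | edge s => exact congrArg Element.edge (hsym s h)

theorem Diagram.map_rename_eq_self {f : ℕ → ℕ} {D : Diagram κ} (h : ∀ p ∈ D.points, f p = p) :
    D.map (rename f) = D :=
  (Multiset.map_congr rfl fun e he =>
    rename_eq_self fun p hp => h p (Multiset.mem_bind.2 ⟨e, he, hp⟩)).trans D.map_id'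

theorem Rewrites.had {C : Diagram κ}
    (h : ({had s(a, x)} + {edge s(b, x)} + C : Diagram κ).IsScalar) :
    Rewrites κ ({had s(a, x)} + {edge s(b, x)} + C) ({had s(a, b)} + C) := by
  obtain ⟨hax, hCx⟩ : a ≠ x ∧ x ∉ C.points := by
    have hx := h.wellFormed x
    simp only [points_add, points_singleton, points_had, points_edge, Multiset.count_add,
      Multiset.count_singleton_self] at hx
    refine ⟨?_, Multiset.count_eq_zero.1 (by omega)⟩
    rintro rfl
    rw [Multiset.count_singleton_self] at hx
    omega
  rw [add_comm {_} {_}, add_assoc] at h ⊢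
  have hstep := Step.topology b x _ (by simp [-Multiset.singleton_add]) h.wellFormed
  have hC : C.map (rename fun p => if p = x then b else p) = C :=
    map_rename_eq_self fun p hp => if_neg (ne_of_mem_of_not_mem hp hCx)
  rw [Multiset.map_add, hC, Multiset.map_singleton, rename, Sym2.map_mk, if_neg hax, if_pos rfl]
    at hstep
  exact .rel _ _ hstep

theorem ReducesTo.contract_had (c : Colour) :
    {had s(a, x)} + {spider c 0 ({x} + {b})} ⇝[κ] {had s(a, b)} :=
  calc
    _ ⇝[κ] {had s(a, x)} + {Element.edge s(x, b)} := by gcongr; exact .cup c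
    _ = {had s(a, x)} + {Element.edge s(b, x)} := by rw [Sym2.eq_swap (a := x)]
    _ ⇝[κ] {had s(a, b)} := fun _ hC =>
      .of_rewrites (R := fun _ => {had s(a, b)}) ![] {x} (fun _ _ h _ => .had h)
        (fun _ => by simp [-Multiset.singleton_add]; abel) fun _ _ => hC

theorem InContext.extend_had (c : Colour) (v : ℕ)
    (h : ∀ x, var x = v → InContext (Reducible κ)
      ({had s(a, x)} + {spider c 0 ({x} + {b})} + K) Q) :
    InContext (Reducible κ) ({had s(a, b)} + K) Q :=
  .bind (p := fun x : Fin 1 → ℕ => ∀ i, var (x i) = ![v] i)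
    (fun _ => .of_rewrites ![v] 0 (R := fun x => {had s(a, x 0)} + {Element.edge s(b, x 0)})
      (fun _ _ _ h => (Rewrites.had h).symm)
      fun x => by simp [-Multiset.singleton_add]; abel)
    fun x hx => calc
      _ = {had s(a, x 0)} + {Element.edge s(x 0, b)} + K := by rw [Sym2.eq_swap (a := b)]
      _ ⇝[κ] {had s(a, x 0)} + {spider c 0 ({x 0} + {b})} + K := by gcongr; exact .edge c
      InContext (Reducible κ) _ Q := h (x 0) (hx 0)

/-- The star rule creates a phase-free node without legs, which the copy rule turns into two copies
of the scalar `⟨0|0⟩`; the star node and one of the copies are split off. -/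
theorem InContext.of_innerProd (hκ : κ = .scaled) (c : Colour)
    (h : ∀ v, InContext (Reducible κ) (ZX.innerProd κ c 0 0 v + K) Q) :
    InContext (Reducible κ) K Q := by
  subst hκ
  have hstar : (0 : Diagram _) ⇝[.scaled] {spider c.swap 0 0} + {.star rfl} :=
    .of_rule 0 (.inr (by rw [add_comm]; exact .star c.swap)) rfl
  have hcopy (x : ℕ) : InContext (Reducible .scaled)
      ({spider c.swap 0 {x}} + {spider c.swap 0 {x}}) fun C => ∀ y : Fin 2 → ℕ,
        (∀ i, var (y i) = ![0, 0] i) → Reducible .scaled (ZX.innerProd .scaled c 0 0 (y 1) +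
          ({spider c.swap 0 {y 0}} + {spider c 0 ({y 0} + ({x} + {x}))}) + C) := fun _ =>
    .of_rule ![0, 0] 0 (fun y => .inr (.copyScaled c x x (y 0) (y 1)))
      fun y => by simp [innerProd_eq, Fin.sum_univ_succ, -Multiset.singleton_add]; abel
  calc K = 0 + K := (zero_add K).symm
    ReducesTo (Reducible _) _ ({spider c.swap 0 0} + {.star rfl} + K) := by gcongr
    _ = {spider c.swap (0 + 0) (0 + 0)} + ({.star rfl} + K) := by simp only [add_zero]; ac_rfl
    InContext (Reducible _) _ Q := InContext.split 0 fun x _ => ?_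
  rw [add_zero]
  refine (hcopy x).bind fun y _ => ?_
  calc ZX.innerProd _ c 0 0 (y 1) + ({spider c.swap 0 {y 0}} + {spider c 0 ({y 0} + ({x} + {x}))}) +
        ({.star rfl} + K)
    _ = ZX.innerProd _ c 0 0 (y 1) + {.star rfl} +
        ({spider c.swap 0 {y 0}} + {spider c 0 ({x} + {x} + {y 0})} + K) := by ac_rfl
    ReducesTo (Reducible _) _ (0 + 0 + ({spider c.swap 0 {y 0}} + {spider c 0 {y 0}} + K)) := by
      gcongr
      · exact .innerProd (y 1)
      · exact .legless rfl
      · exact .loop x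
    _ = ZX.innerProd _ c 0 0 (y 0) + K := by rw [innerProd_eq, zero_add, zero_add]; ac_rfl
    InContext (Reducible _) _ Q := h (y 0)

theorem InContext.bialgebra
    (h : ∀ u, InContext (Reducible κ)
      ({spider c.swap 0 ({a} + {b} + {u})} + {spider c 0 ({u} + {p} + {q})} + K) Q) :
    InContext (Reducible κ)
      ({spider c 0 ({a} + {w} + {x})} + {spider c 0 ({b} + {y} + {z})} +
        {spider c.swap 0 ({w} + {y} + {p})} + {spider c.swap 0 ({x} + {z} + {q})} + K) Q := by
  cases κ with
  | scalarFree =>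
    refine .bind (fun _ => .of_rule ![0] {w, x, y, z}
      (fun u => .inl (.bialgebra c a b p q w x y z (u 0))) fun u => ?_) fun u _ => h (u 0)
    simp [← Multiset.singleton_add]
    abel
  | scaled =>
    refine .of_innerProd rfl c fun v => ?_
    rw [← add_assoc]
    refine .bind (fun _ => .of_rule ![0] {w, x, y, z, v}
      (fun u => .inl (.bialgebraScaled c a b p q w x y z (u 0) v)) fun u => ?_) fun u _ => h (u 0)
    simp [innerProd_eq, ← Multiset.singleton_add]
    abel

theorem InContext.unbialgebra (v v' : ℕ)
    (h : ∀ w x y z, var w = v → var x = v → var y = v' → var z = v' → InContext (Reducible κ)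
      ({spider c 0 ({a} + {w} + {x})} + {spider c 0 ({b} + {y} + {z})} +
        {spider c.swap 0 ({w} + {y} + {p})} + {spider c.swap 0 ({x} + {z} + {q})} + K) Q) :
    InContext (Reducible κ)
      ({spider c.swap 0 ({a} + {b} + {u})} + {spider c 0 ({u} + {p} + {q})} + K) Q := by
  cases κ with
  | scalarFree =>
    refine .bind (fun _ => .of_rule ![v, v, v', v'] {u}
      (fun i => .inr (.bialgebra c a b p q (i 0) (i 1) (i 2) (i 3) u)) fun i => ?_)
      fun i hi => h (i 0) (i 1) (i 2) (i 3) (hi 0) (hi 1) (hi 2) (hi 3)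
    simp [Fin.sum_univ_succ, ← Multiset.singleton_add]
    abel
  | scaled =>
    refine .bind (fun _ => .of_rule ![v, v, v', v', 0] {u}
      (fun i => .inr (.bialgebraScaled c a b p q (i 0) (i 1) (i 2) (i 3) u (i 4))) fun i => ?_)
      fun i hi => .innerProd_add (i 4)
        (h (i 0) (i 1) (i 2) (i 3) (hi 0) (hi 1) (hi 2) (hi 3))
    simp [innerProd_eq, Fin.sum_univ_succ, ← Multiset.singleton_add]
    abel

theorem ReducesTo.copy :
    {spider c.swap 0 {x}} + {spider c 0 ({x} + {a} + {b})} ⇝[κ]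
      {spider c.swap 0 {a}} + {spider c.swap 0 {b}} := by
  cases κ with
  | scalarFree =>
    refine .of_rule {x} (.inl (.copy c a b x)) ?_
    simp [-Multiset.singleton_add]
    abel
  | scaled =>
    refine InContext.of_innerProd rfl c fun v =>
      ReducesTo.of_rule ({x} + {v}) (.inl (.copyScaled c a b x v)) ?_
    simp [innerProd_eq, - Multiset.singleton_add]
    abel

theorem ReducesTo.copy_swap :
    {spider c 0 {x}} + {spider c.swap 0 ({x} + {a} + {b})} ⇝[κ]
      {spider c 0 {a}} + {spider c 0 {b}} := by
  simpa only [c.swap_swap] using copy (c := c.swap)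

theorem InContext.pi_commute
    (h : ∀ y, InContext (Reducible κ)
      ({spider c (-j) ({a} + {y})} + {spider c.swap 2 ({y} + {b})} + K) Q) :
    InContext (Reducible κ) ({spider c.swap 2 ({a} + {x})} + {spider c j ({x} + {b})} + K) Q := by
  cases κ with
  | scalarFree =>
    refine .bind (fun _ => .of_rule ![0] {x} (fun i => .inl (.piComm c j a b x (i 0)))
      fun i => ?_) fun i _ => h (i 0)
    simp [← Multiset.singleton_add]
    abel
  | scaled =>
    refine .of_innerProd rfl c fun v => ?_
    rw [← add_assoc]
    refine .bind (fun _ => .of_rule ![0, 0] {x, v}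
      (fun i => .inl (.piCommScaled c j a b x (i 0) v (i 1))) fun i => ?_)
      fun i _ => .innerProd_add (i 1) (h (i 0))
    simp [innerProd_eq, Fin.sum_univ_succ, ← Multiset.singleton_add]
    abel

theorem InContext.euler (c : Colour)
    (h : ∀ x y, InContext (Reducible κ) ({spider c 1 ({a} + {x})} +
      {spider c.swap 1 ({x} + {y})} + {spider c 1 ({y} + {b})} + K) Q) :
    InContext (Reducible κ) ({had s(a, b)} + K) Q := by
  cases κ with
  | scalarFree =>
    refine .bind (fun _ => .of_rule ![0, 0] 0 (fun i => .inl (.euler c a b (i 0) (i 1)))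
      fun i => ?_) fun i _ => h (i 0) (i 1)
    simp [Fin.sum_univ_succ, ← Multiset.singleton_add]
    abel
  | scaled =>
    refine .of_innerProd rfl c fun v' => .of_innerProd rfl c fun v => ?_
    rw [← add_assoc, ← add_assoc]
    refine .bind (fun _ => .of_rule ![0, 0, 0] {v, v'}
      (fun i => .inl (.eulerScaled c a b (i 0) (i 1) v v' (i 2))) fun i => ?_)
      fun i _ => .innerProd_add (i 2) (h (i 0) (i 1))
    simp [innerProd_eq, Fin.sum_univ_succ, ← Multiset.singleton_add]
    abel

theorem InContext.pi_copy
    (h : ∀ x y, InContext (Reducible κ) ({spider c 0 ({a} + {x} + {y})} +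
      {spider c.swap 2 ({x} + {s})} + {spider c.swap 2 ({y} + {t})} + K) Q) :
    InContext (Reducible κ)
      ({spider c.swap 2 ({a} + {r})} + {spider c 0 ({r} + {s} + {t})} + K) Q := by
  refine .bind (fun _ => .of_rule ![0, 0] {r}
    (fun i => .inl (.piCopy κ c a r {(s, i 0), (t, i 1)})) fun i => ?_) fun i _ => h (i 0) (i 1)
  simp [Fin.sum_univ_succ, ← Multiset.singleton_add]
  abel

end Rules

section DerivedRules

variable {κ : Calculus} {c : Colour} {j k : ZMod 4} {a b n p q r s t w x y : ℕ} {A : Multiset ℕ}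
  {K : Diagram κ} {Q : Diagram κ → Prop}

theorem ReducesTo.wire (c' : Colour) :
    {spider c k ({x} + A)} + {spider c' 0 ({x} + {y})} ⇝[κ] {spider c k ({y} + A)} :=
  calc
    _ ⇝[κ] {spider c k ({x} + A)} + {spider c 0 ({x} + {y})} := by gcongr; exact .recolour c' c
    _ ⇝[κ] {spider c k (A + {y})} := by exact .merge_zero x
    _ = {spider c k ({y} + A)} := by ac_rfl

theorem InContext.unwire (c' : Colour) (v : ℕ)
    (h : ∀ x, var x = v → InContext (Reducible κ)
      ({spider c k ({x} + A)} + {spider c' 0 ({x} + {y})} + K) Q) :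
    InContext (Reducible κ) ({spider c k ({y} + A)} + K) Q :=
  calc
    _ = {spider c k (A + {y})} + K := by ac_rfl
    InContext (Reducible κ) _ Q := .split_zero v fun x hx => calc
      _ ⇝[κ] {spider c k ({x} + A)} + {spider c' 0 ({x} + {y})} + K := by
        gcongr; exact .recolour c c'
      InContext (Reducible κ) _ Q := h x hx

theorem ReducesTo.state_through :
    {spider c 0 {b}} + {spider c.swap k ({b} + {y})} ⇝[κ] {spider c 0 {y}} :=
  calc
    _ = {spider c.swap k (0 + ({b} + {y}))} + {spider c 0 {b}} := by rw [zero_add, add_comm]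
    _ ⇝[κ] {spider c 0 {y}} := InContext.split_zero 0 fun x _ => calc
      _ = {spider c 0 {b}} + {spider c.swap 0 ({b} + {x} + {y})} + {spider c.swap k {x}} := by
        rw [add_zero]; ac_rfl
      _ ⇝[κ] {spider c 0 {x}} + {spider c 0 {y}} + {spider c.swap k {x}} := by
        gcongr ?_ + _; exact .copy_swap
      _ = ZX.innerProd κ c 0 k x + {spider c 0 {y}} := by rw [innerProd_eq]; ac_rfl
      _ ⇝[κ] 0 + {spider c 0 {y}} := by gcongr; exact .innerProd x
      _ = {spider c 0 {y}} := zero_add _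

theorem exists_of_map_eq_singleton_add {α β : Type*} {f : α → β} {s : Multiset α} {b : β}
    {t : Multiset β} (h : s.map f = {b} + t) :
    ∃ a s', s = {a} + s' ∧ f a = b ∧ s'.map f = t := by
  classical
  rw [Multiset.singleton_add, ← Multiset.map_eq_cons] at h
  obtain ⟨a, ha, hb, h⟩ := h
  exact ⟨a, s.erase a, by rw [Multiset.singleton_add, Multiset.cons_erase ha], hb, h⟩

theorem exists_pair_of_map_fst {P : Multiset (ℕ × ℕ)} (h : P.map Prod.fst = {a} + A) :
    ∃ x P', P = {(a, x)} + P' ∧ P'.map Prod.fst = A := by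
  obtain ⟨⟨_, x⟩, P', rfl, rfl, hP⟩ := exists_of_map_eq_singleton_add h
  exact ⟨x, P', rfl, hP⟩

theorem exists_eq_singleton_of_map_fst {P : Multiset (ℕ × ℕ)} (h : P.map Prod.fst = {a}) :
    ∃ x, P = {(a, x)} := by
  obtain ⟨⟨_, x⟩, rfl, rfl⟩ := Multiset.map_eq_singleton.1 h
  exact ⟨x, rfl⟩

theorem InContext.colour_one (v : ℕ)
    (h : ∀ x, var x = v → InContext (Reducible κ) ({spider c.swap k {x}} + {had s(a, x)} + K) Q) :
    InContext (Reducible κ) ({spider c k {a}} + K) Q :=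
  .colour v fun P hP hv => by
    obtain ⟨x, rfl⟩ := exists_eq_singleton_of_map_fst hP
    exact h x (hv (a, x) (by simp))

theorem ReducesTo.had_had_cup (c : Colour) :
    {had s(p, q)} + {had s(q, r)} ⇝[κ] {spider c 0 ({p} + {r})} :=
  calc
    _ = {had s(r, q)} + {had s(p, q)} := by rw [add_comm, had_comm q]
    _ ⇝[κ] _ := InContext.extend_had c.swap 0 fun x _ => calc
      _ = {spider c.swap 0 (({(p, q)} + {(r, x)} : Multiset (ℕ × ℕ)).map Prod.snd)} +
          hads κ ({(p, q)} + {(r, x)}) := by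
        simp only [hads_add, hads_singleton, Multiset.map_add, Multiset.map_singleton]
        ac_rfl
      _ ⇝[κ] {spider c 0 ({p} + {r})} := by simpa using uncolour ({(p, q)} + {(r, x)})

theorem ReducesTo.had_had (q : ℕ) :
    {spider c k ({p} + A)} + {had s(p, q)} + {had s(q, r)} ⇝[κ] {spider c k ({r} + A)} :=
  calc
    _ = {spider c k ({p} + A)} + ({had s(p, q)} + {had s(q, r)}) := add_assoc _ _ _
    _ ⇝[κ] {spider c k ({p} + A)} + {spider c 0 ({p} + {r})} := by
      gcongr _ + ?_; exact .had_had_cup c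
    _ ⇝[κ] _ := by exact .wire c

theorem InContext.cup_had_had
    (h : ∀ q, InContext (Reducible κ) ({had s(p, q)} + {had s(q, r)} + K) Q) :
    InContext (Reducible κ) ({spider c 0 ({p} + {r})} + K) Q :=
  .colour 0 fun P hP _ => by
    obtain ⟨x, P, rfl, hP'⟩ := exists_pair_of_map_fst hP
    obtain ⟨y, rfl⟩ := exists_eq_singleton_of_map_fst hP'
    calc
      _ = {had s(p, x)} + ({had s(r, y)} + {spider c.swap 0 ({y} + {x})}) + K := by
        simp only [hads_add, hads_singleton, Multiset.map_add, Multiset.map_singleton]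
        ac_rfl
      _ ⇝[κ] {had s(p, x)} + {had s(r, x)} + K := by gcongr _ + ?_ + _; exact .contract_had c.swap
      _ = {had s(p, x)} + {had s(x, r)} + K := by rw [had_comm r]
      InContext (Reducible κ) _ Q := h x

theorem InContext.push_had (v : ℕ)
    (h : ∀ P : Multiset (ℕ × ℕ), P.map Prod.fst = A → (∀ p ∈ P, var p.2 = v) →
      InContext (Reducible κ) ({spider c.swap k ({n} + P.map Prod.snd)} + hads κ P + K) Q) :
    InContext (Reducible κ) ({spider c k ({s} + A)} + {had s(s, n)} + K) Q := by
  rw [add_assoc]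
  refine .colour v fun P hP hv => ?_
  obtain ⟨x, P, rfl, hP'⟩ := exists_pair_of_map_fst hP
  calc
    _ = {spider c.swap k ({x} + P.map Prod.snd)} + {had s(x, s)} + {had s(s, n)} +
        (hads κ P + K) := by
      simp only [hads_add, hads_singleton, Multiset.map_add, Multiset.map_singleton, had_comm s x]
      ac_rfl
    _ ⇝[κ] {spider c.swap k ({n} + P.map Prod.snd)} + (hads κ P + K) := by
      gcongr ?_ + _; exact .had_had s
    _ = {spider c.swap k ({n} + P.map Prod.snd)} + hads κ P + K := by ac_rfl
    InContext (Reducible κ) _ Q := h P hP' fun p hp => hv p (Multiset.mem_add.2 (.inr hp))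

theorem InContext.push_had_one (v : ℕ)
    (h : ∀ y, var y = v →
      InContext (Reducible κ) ({spider c.swap k ({n} + {y})} + {had s(x, y)} + K) Q) :
    InContext (Reducible κ) ({spider c k ({s} + {x})} + {had s(s, n)} + K) Q :=
  .push_had v fun P hP hv => by
    obtain ⟨y, rfl⟩ := exists_eq_singleton_of_map_fst hP
    exact h y (hv (x, y) (by simp))

theorem ReducesTo.state_through_had :
    {spider c k {s}} + {had s(s, n)} ⇝[κ] {spider c.swap k {n}} :=
  calc
    _ = {spider c k ({s} + 0)} + {had s(s, n)} + 0 := by rw [add_zero, add_zero]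
    _ ⇝[κ] _ := InContext.push_had 0 fun P hP _ => by
      obtain rfl := Multiset.map_eq_zero.1 hP
      exact ReducesTo.of_eq (by simp [hads])

theorem ReducesTo.state_three : {spider c.swap 3 {q}} ⇝[κ] {spider c 1 {q}} :=
  calc
    _ = {spider c.swap 3 {q}} + 0 := (add_zero _).symm
    _ ⇝[κ] _ := InContext.split_state 0 fun x _ => calc
      _ = {spider c.swap 0 {x}} + {spider c.swap 3 ({x} + {q})} := by rw [add_zero, add_comm]
      _ ⇝[κ] _ := InContext.colour_one 0 fun y _ => calc
        _ = {had s(x, y)} + ({spider c 0 {y}} + {spider c.swap 3 ({x} + {q})}) := by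
          rw [c.swap_swap]; ac_rfl
        _ ⇝[κ] _ := InContext.euler c.swap fun u v => calc
          _ = {spider c 0 {y}} + {spider c.swap 1 ({y} + {v})} + {spider c 1 ({v} + {u})} +
              ({spider c.swap 3 ({x} + {q})} + {spider c.swap 1 ({x} + {u})}) := by
            rw [c.swap_swap]; ac_rfl
          _ ⇝[κ] {spider c 0 {v}} + {spider c 1 ({v} + {u})} +
              {spider c.swap (3 + 1) ({q} + {u})} := by
            gcongr ?_ + _ + ?_
            · exact .state_through
            · exact .merge x
          _ = {spider c 1 ({v} + {u})} + {spider c 0 {v}} + {spider c.swap 0 ({u} + {q})} := by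
            rw [show (3 + 1 : ZMod 4) = 0 from rfl]; ac_rfl
          _ ⇝[κ] {spider c 1 {u}} + {spider c.swap 0 ({u} + {q})} := by
            gcongr ?_ + _; exact .merge_state v
          _ ⇝[κ] {spider c 1 {q}} := by simpa only [add_zero] using wire (A := 0) c.swap

theorem ReducesTo.state_one : {spider c.swap 1 {q}} ⇝[κ] {spider c 3 {q}} :=
  calc
    _ = {spider c.swap (2 + 3) ({q} + 0)} + 0 := by rw [add_zero, add_zero]; rfl
    _ ⇝[κ] _ := InContext.split 0 fun x _ => calc
      _ = {spider c.swap 3 {x}} + {spider c.swap 2 ({x} + {q})} := by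
        rw [add_zero, add_zero, add_comm]
      _ ⇝[κ] {spider c 1 {x}} + {spider c.swap 2 ({x} + {q})} := by
        gcongr ?_ + _; exact .state_three
      _ ⇝[κ] _ := InContext.split_state 0 fun b _ => calc
        _ = {spider c.swap 2 ({q} + {x})} + {spider c 1 ({x} + {b})} + {spider c 0 {b}} := by
          ac_rfl
        _ ⇝[κ] _ := InContext.pi_commute fun y => calc
          _ = {spider c 0 {b}} + {spider c.swap 2 ({b} + {y})} + {spider c 3 ({y} + {q})} := by
            rw [show (-1 : ZMod 4) = 3 from rfl]; ac_rfl
          _ ⇝[κ] {spider c 0 {y}} + {spider c 3 ({y} + {q})} := by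
            gcongr ?_ + _; exact .state_through
          _ = {spider c 3 ({y} + {q})} + {spider c 0 {y}} := add_comm _ _
          _ ⇝[κ] {spider c 3 {q}} := by exact .merge_state y

theorem InContext.wire_three (v v' : ℕ)
    (h : ∀ u w, var u = v → var w = v' → InContext (Reducible κ)
      ({spider c 1 ({x} + {u})} + {had s(u, w)} + {spider c 1 ({w} + {y})} + K) Q) :
    InContext (Reducible κ) ({spider c.swap 3 ({x} + {y})} + K) Q :=
  .split_zero 0 fun z _ => calc
    _ = {spider c.swap 0 ({z} + {y})} + ({spider c.swap 3 ({z} + {x})} + K) := by ac_rfl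
    InContext (Reducible κ) _ Q := .cup_had_had fun s => calc
      _ = {had s(z, s)} + ({had s(s, y)} + {spider c.swap 3 ({z} + {x})} + K) := by ac_rfl
      InContext (Reducible κ) _ Q := .euler c.swap fun u w => calc
        _ = {spider c.swap 3 ({z} + {x})} + {spider c.swap 1 ({z} + {u})} +
            {spider c 1 ({u} + {w})} + ({spider c.swap 1 ({s} + {w})} + {had s(s, y)} + K) := by
          rw [c.swap_swap]; ac_rfl
        _ ⇝[κ] {spider c.swap (3 + 1) ({x} + {u})} + {spider c 1 ({u} + {w})} +
            ({spider c.swap 1 ({s} + {w})} + {had s(s, y)} + K) := by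
          gcongr ?_ + _ + _; exact .merge z
        _ = {spider c 1 ({u} + {w})} + {spider c.swap 0 ({u} + {x})} +
            ({spider c.swap 1 ({s} + {w})} + {had s(s, y)} + K) := by
          rw [show (3 + 1 : ZMod 4) = 0 from rfl]; ac_rfl
        _ ⇝[κ] {spider c 1 ({x} + {w})} +
            ({spider c.swap 1 ({s} + {w})} + {had s(s, y)} + K) := by
          gcongr ?_ + _; exact .wire c.swap
        _ = {spider c.swap 1 ({s} + {w})} + {had s(s, y)} + ({spider c 1 ({x} + {w})} + K) := by
          ac_rfl
        InContext (Reducible κ) _ Q := .push_had_one v' fun t ht => calc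
          _ = {had s(t, w)} + ({spider c 1 ({y} + {t})} + {spider c 1 ({x} + {w})} + K) := by
            rw [c.swap_swap, had_comm w]; ac_rfl
          InContext (Reducible κ) _ Q := .extend_had c v fun u hu => calc
            _ = {spider c 1 ({w} + {x})} + {spider c 0 ({w} + {u})} +
                ({had s(t, u)} + {spider c 1 ({y} + {t})} + K) := by ac_rfl
            _ ⇝[κ] {spider c 1 ({x} + {u})} +
                ({had s(t, u)} + {spider c 1 ({y} + {t})} + K) := by
              gcongr ?_ + _; exact .merge_zero w
            _ = {spider c 1 ({x} + {u})} + {had s(u, t)} + {spider c 1 ({t} + {y})} + K := by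
              rw [had_comm t]; ac_rfl
            InContext (Reducible κ) _ Q := h u t hu ht

theorem ReducesTo.bialgebra_states :
    {spider c 0 ({t} + {w} + {q})} + {spider c 0 ({y} + {p})} +
      {spider c.swap 0 ({w} + {y})} + {spider c.swap 0 ({q} + {p} + {s})} ⇝[κ]
      {spider c 0 {t}} + {spider c.swap 0 {s}} :=
  calc
    _ = {spider c 0 ({y} + {p})} + ({spider c 0 ({t} + {w} + {q})} +
        {spider c.swap 0 ({w} + {y})} + {spider c.swap 0 ({q} + {p} + {s})}) := by ac_rfl
    _ ⇝[κ] _ := InContext.split_state 0 fun b _ => calc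
      _ = {spider c.swap 0 ({w} + {y})} + ({spider c 0 ({t} + {w} + {q})} +
          {spider c 0 ({b} + ({y} + {p}))} + {spider c 0 {b}} +
          {spider c.swap 0 ({q} + {p} + {s})}) := by ac_rfl
      _ ⇝[κ] _ := InContext.split_state 0 fun r _ => calc
        _ = {spider c 0 ({t} + {w} + {q})} + {spider c 0 ({b} + {y} + {p})} +
            {spider c.swap 0 ({w} + {y} + {r})} + {spider c.swap 0 ({q} + {p} + {s})} +
            ({spider c.swap 0 {r}} + {spider c 0 {b}}) := by ac_rfl
        _ ⇝[κ] _ := InContext.bialgebra fun u => calc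
          _ = {spider c 0 {b}} + {spider c.swap 0 ({b} + {t} + {u})} +
              ({spider c 0 ({u} + {r} + {s})} + {spider c.swap 0 {r}}) := by ac_rfl
          _ ⇝[κ] {spider c 0 {t}} + {spider c 0 {u}} +
              ({spider c 0 ({u} + {r} + {s})} + {spider c.swap 0 {r}}) := by
            gcongr ?_ + _; exact .copy_swap
          _ = {spider c 0 ({u} + ({r} + {s}))} + {spider c 0 {u}} +
              {spider c.swap 0 {r}} + {spider c 0 {t}} := by ac_rfl
          _ ⇝[κ] {spider c 0 ({r} + {s})} + {spider c.swap 0 {r}} + {spider c 0 {t}} := by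
            gcongr ?_ + _ + _; exact .merge_state u
          _ = {spider c 0 {t}} + ({spider c.swap 0 {r}} + {spider c 0 ({r} + {s})}) := by ac_rfl
          _ ⇝[κ] {spider c 0 {t}} + {spider c.swap 0 {s}} := by
            gcongr; simpa only [add_zero] using wire (A := 0) c

/- The Hopf law follows from the bialgebra rule once one of the two parallel wires has been cut by
a green and a red node. -/

theorem ReducesTo.hopf_phaseless :
    {spider c 0 ({t} + {p} + {q})} + {spider c.swap 0 ({p} + {q} + {s})} ⇝[κ]
      {spider c 0 {t}} + {spider c.swap 0 {s}} :=
  calc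
    _ = {spider c 0 ({p} + ({t} + {q}))} + {spider c.swap 0 ({p} + {q} + {s})} := by ac_rfl
    _ ⇝[κ] _ := InContext.unwire c.swap 0 fun w _ => calc
      _ = {spider c.swap 0 ({p} + {w})} +
          ({spider c 0 ({w} + ({t} + {q}))} + {spider c.swap 0 ({p} + {q} + {s})}) := by ac_rfl
      _ ⇝[κ] _ := InContext.unwire c 0 fun y _ => calc
        _ = {spider c 0 ({t} + {w} + {q})} + {spider c 0 ({y} + {p})} +
            {spider c.swap 0 ({w} + {y})} + {spider c.swap 0 ({q} + {p} + {s})} := by ac_rfl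
        _ ⇝[κ] {spider c 0 {t}} + {spider c.swap 0 {s}} := by exact .bialgebra_states

theorem ReducesTo.hopf :
    {spider c k ({t} + {p} + {q})} + {spider c.swap j ({p} + {q} + A)} ⇝[κ]
      {spider c k {t}} + {spider c.swap j A} :=
  calc
    _ = {spider c k ({t} + ({p} + {q}))} + {spider c.swap j ({p} + {q} + A)} := by ac_rfl
    _ ⇝[κ] _ := InContext.split_zero 0 fun x _ => calc
      _ = {spider c.swap j (A + ({p} + {q}))} +
          ({spider c k ({x} + {t})} + {spider c 0 ({x} + ({p} + {q}))}) := by ac_rfl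
      _ ⇝[κ] _ := InContext.split_zero 0 fun y _ => calc
        _ = {spider c k ({x} + {t})} + {spider c.swap j ({y} + A)} +
            ({spider c 0 ({x} + {p} + {q})} + {spider c.swap 0 ({p} + {q} + {y})}) := by ac_rfl
        _ ⇝[κ] {spider c k ({x} + {t})} + {spider c.swap j ({y} + A)} +
            ({spider c 0 {x}} + {spider c.swap 0 {y}}) := by
          gcongr _ + _ + ?_; exact .hopf_phaseless
        _ = {spider c k ({x} + {t})} + {spider c 0 {x}} +
            ({spider c.swap j ({y} + A)} + {spider c.swap 0 {y}}) := by ac_rfl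
        _ ⇝[κ] {spider c k {t}} + {spider c.swap j A} := by
          gcongr ?_ + ?_
          · exact .merge_state x
          · exact .merge_state y

theorem ReducesTo.self_had :
    {spider c 0 ({t} + {p} + {q})} + {had s(p, q)} ⇝[κ] {spider c 2 {t}} :=
  calc
    _ = {had s(p, q)} + {spider c 0 ({t} + {p} + {q})} := add_comm _ _
    _ ⇝[κ] _ := InContext.euler c fun u v => calc
      _ = {spider c 1 ({p} + {u})} + {spider c 0 ({p} + ({t} + {q}))} +
          {spider c 1 ({q} + {v})} + {spider c.swap 1 ({u} + {v})} := by ac_rfl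
      _ ⇝[κ] {spider c 1 ({u} + ({t} + {q}))} + {spider c 1 ({q} + {v})} +
          {spider c.swap 1 ({u} + {v})} := by
        gcongr ?_ + _ + _; exact .merge_zero p
      _ = {spider c 1 ({q} + ({u} + {t}))} + {spider c 1 ({q} + {v})} +
          {spider c.swap 1 ({u} + {v})} := by ac_rfl
      _ ⇝[κ] {spider c (1 + 1) ({u} + {t} + {v})} + {spider c.swap 1 ({u} + {v})} := by
        gcongr ?_ + _; exact .merge q
      _ = {spider c 2 ({t} + {u} + {v})} + {spider c.swap 1 ({u} + {v} + 0)} := by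
        rw [add_zero, show (1 + 1 : ZMod 4) = 2 from rfl]; ac_rfl
      _ ⇝[κ] {spider c 2 {t}} + {spider c.swap 1 0} := by exact .hopf
      _ ⇝[κ] {spider c 2 {t}} + 0 := by gcongr; exact .legless rfl
      _ = {spider c 2 {t}} := add_zero _

theorem ReducesTo.copy_even (hk : k = 0 ∨ k = 2) :
    {spider c.swap k {r}} + {spider c 0 ({r} + {s} + {t})} ⇝[κ]
      {spider c.swap k {s}} + {spider c.swap k {t}} := by
  rcases hk with rfl | rfl
  · exact .copy
  calc
    _ ⇝[κ] _ := InContext.split_state 0 fun a _ => calc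
      _ = {spider c.swap 2 ({a} + {r})} + {spider c 0 ({r} + {s} + {t})} +
          {spider c.swap 0 {a}} := by ac_rfl
      _ ⇝[κ] _ := InContext.pi_copy fun x y => calc
        _ = {spider c.swap 0 {a}} + {spider c 0 ({a} + {x} + {y})} +
            ({spider c.swap 2 ({x} + {s})} + {spider c.swap 2 ({y} + {t})}) := by ac_rfl
        _ ⇝[κ] {spider c.swap 0 {x}} + {spider c.swap 0 {y}} +
            ({spider c.swap 2 ({x} + {s})} + {spider c.swap 2 ({y} + {t})}) := by
          gcongr ?_ + _; exact .copy
        _ = {spider c.swap 2 ({x} + {s})} + {spider c.swap 0 {x}} +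
            ({spider c.swap 2 ({y} + {t})} + {spider c.swap 0 {y}}) := by ac_rfl
        _ ⇝[κ] {spider c.swap 2 {s}} + {spider c.swap 2 {t}} := by
          gcongr ?_ + ?_
          · exact .merge_state x
          · exact .merge_state y

end DerivedRules

section Variables

variable {κ : Calculus} {c : Colour} {j k : ZMod 4} {a b p u v : ℕ} {A N P : Multiset ℕ}
  {E K R T : Diagram κ} {Q : Diagram κ → Prop}

/-- One phase-free green node for each variable that occurs in `P`, with a leg for each of the
points of `P` that belong to this variable. -/
def link (κ : Calculus) (P : Multiset ℕ) : Diagram κ :=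
  (P.map var).dedup.map fun v => spider .green 0 (P.filter (var · = v))

theorem link_eq (hv : v ∈ P.map var) :
    link κ P = {spider .green 0 (P.filter (var · = v))} + link κ (P.filter (var · ≠ v)) := by
  have hvar : (P.map var).dedup = v ::ₘ ((P.filter (var · ≠ v)).map var).dedup := by
    refine (Multiset.nodup_dedup _).ext ?_ |>.2 fun w => ?_
    · simp
    · by_cases hw : w = v
      · simpa [hw] using hv
      · simp only [Multiset.mem_dedup, Multiset.mem_map, Multiset.mem_cons, hw, false_or,
          Multiset.mem_filter]
        exact ⟨fun ⟨p, hp, h⟩ => ⟨p, ⟨hp, h ▸ hw⟩, h⟩, fun ⟨p, ⟨hp, _⟩, h⟩ => ⟨p, hp, h⟩⟩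
  rw [link, hvar, Multiset.map_cons, Multiset.singleton_add, link]
  congr 1
  refine Multiset.map_congr rfl fun w hw => ?_
  rw [Multiset.filter_filter]
  congr 1
  refine Multiset.filter_congr fun p _ => ⟨fun h => ⟨h, ?_⟩, And.left⟩
  obtain ⟨q, hq, rfl⟩ := Multiset.mem_map.1 (Multiset.mem_dedup.1 hw)
  exact h ▸ (Multiset.mem_filter.1 hq).2

theorem link_add_eq (hv : v ∈ (A + P).map var) (hA : ∀ a ∈ A, var a = v) :
    link κ (A + P) =
      {spider .green 0 (A + P.filter (var · = v))} + link κ (P.filter (var · ≠ v)) := by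
  rw [link_eq hv, Multiset.filter_add, Multiset.filter_eq_self.2 hA, Multiset.filter_add,
    Multiset.filter_eq_nil (p := (var · ≠ v)).2 fun a ha h => h (hA a ha), zero_add]

theorem link_add_eq_of_notMem (hA₀ : A ≠ 0) (hA : ∀ a ∈ A, var a = v) (hP : v ∉ P.map var) :
    link κ (A + P) = {spider .green 0 A} + link κ P := by
  have hP' p (hp : p ∈ P) : var p ≠ v := fun h => hP (h ▸ Multiset.mem_map_of_mem _ hp)
  obtain ⟨a, ha⟩ := Multiset.exists_mem_of_ne_zero hA₀
  rw [link_add_eq (v := v) (by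
    simpa using .inl ⟨a, ha, hA a ha⟩) hA, Multiset.filter_eq_nil.2 hP',
    Multiset.filter_eq_self.2 hP', add_zero]

theorem InContext.detach (v : ℕ) (hv : v ∈ (A + P).map var) (hA : ∀ a ∈ A, var a = v)
    (h : ∀ x, var x = v →
      InContext (Reducible κ) ({spider .green 0 ({x} + A)} + link κ ({x} + P) + K) Q) :
    InContext (Reducible κ) (link κ (A + P) + K) Q :=
  calc
    _ = {spider .green 0 (A + P.filter (var · = v))} + (link κ (P.filter (var · ≠ v)) + K) := by
      rw [link_add_eq hv hA, add_assoc]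
    InContext (Reducible κ) _ Q := .split_zero v fun x hx => calc
      _ = {spider .green 0 ({x} + A)} + link κ ({x} + P) + K := by
        rw [link_add_eq (v := v) (A := {x}) (by simp [hx]) (by simpa using hx)]
        ac_rfl
      InContext (Reducible κ) _ Q := h x hx

theorem ReducesTo.attach (hp : var p = v) (hA : ∀ a ∈ A, var a = v) :
    {spider .green 0 ({p} + A)} + link κ ({p} + P) ⇝[κ] link κ (A + P) := by
  calc
    _ = {spider .green 0 ({p} + A)} + {spider .green 0 ({p} + P.filter (var · = v))} +
        link κ (P.filter (var · ≠ v)) := by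
      rw [link_add_eq (v := v) (A := {p}) (by simp [hp]) (by simpa using hp), add_assoc]
    _ ⇝[κ] {spider .green 0 (A + P.filter (var · = v))} + link κ (P.filter (var · ≠ v)) := by
      gcongr ?_ + _; exact .merge_zero p
    _ ⇝[κ] link κ (A + P) := ?_
  by_cases hv : v ∈ (A + P).map var
  · exact .of_eq (link_add_eq hv hA).symm
  · have hne q (hq : q ∈ A + P) : var q ≠ v := fun h => hv (h ▸ Multiset.mem_map_of_mem _ hq)
    obtain rfl : A = 0 := Multiset.eq_zero_of_forall_notMem fun a ha =>
      hne a (Multiset.mem_add.2 (.inl ha)) (hA a ha)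
    rw [zero_add] at hne ⊢
    rw [Multiset.filter_eq_nil.2 hne, Multiset.filter_eq_self.2 hne, zero_add]
    calc
      _ ⇝[κ] 0 + link κ P := by gcongr; exact .legless rfl
      _ = link κ P := zero_add _

/-- Reducibility of the diagrams in which the points of `T` are variables, that is, in which all
ends with the same name are joined by a phase-free green node. -/
def VarReducible (κ : Calculus) (T : Diagram κ) : Prop :=
  ∀ E : Diagram κ, E.map (rename var) = T → Reducible κ (E + link κ E.points)

notation:50 L:51 "⇝ᵥ[" κ "]" R:51 => ReducesTo (VarReducible κ) L R

/-- The context `C`, which meets the variables in the points `P`, makes every diagram with variables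
`R` reducible. -/
def Completes (κ : Calculus) (R : Diagram κ) (P : Multiset ℕ) (C : Diagram κ) : Prop :=
  ∀ E : Diagram κ, E.map (rename var) = R → Reducible κ (E + link κ (E.points + P) + C)

theorem InContext.completes (hR : E.map (rename var) = R)
    (hA : Diagram.points E = A := by simp [add_assoc, -Multiset.singleton_add]) :
    InContext (Reducible κ) (E + link κ (A + P)) (Completes κ R P) := hA ▸ fun _ hC => hC E hR

theorem Element.points_rename (f : ℕ → ℕ) (e : Element κ) :
    (e.rename f).points = e.points.map f := by
  have hsym (s : Sym2 ℕ) : (s.map f).toMultiset = s.toMultiset.map f := by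
    induction s with | _ a b => rfl
  cases e with
  | spider c k A => rfl
  | had s => exact hsym s
  | star h => rfl
  | edge s => exact hsym s

theorem Diagram.points_map_rename (f : ℕ → ℕ) (D : Diagram κ) :
    points (D.map (rename f)) = D.points.map f := by
  rw [points, Multiset.bind_map, points, Multiset.map_bind]
  exact Multiset.bind_congr fun e _ => points_rename f e

theorem exists_of_map_eq_add {α β : Type*} {f : α → β} {s : Multiset α} {t u : Multiset β}
    (h : s.map f = t + u) : ∃ s₁ s₂, s = s₁ + s₂ ∧ s₁.map f = t ∧ s₂.map f = u := by
  induction t using Multiset.induction generalizing s with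
  | empty => exact ⟨0, s, (zero_add s).symm, rfl, by rwa [zero_add] at h⟩
  | cons b t ih =>
    rw [← Multiset.singleton_add, add_assoc] at h
    obtain ⟨a, s, rfl, rfl, hs⟩ := exists_of_map_eq_singleton_add h
    obtain ⟨s₁, s₂, rfl, rfl, hu⟩ := ih hs
    exact ⟨{a} + s₁, s₂, (add_assoc _ _ _).symm, by simp, hu⟩

theorem VarReducible.lift {L : Diagram κ} (hR : VarReducible κ (R + T))
    (h : ∀ E P, E.map (rename var) = L → P.map var = T.points →
      InContext (Reducible κ) (E + link κ (E.points + P)) (Completes κ R P)) :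
    VarReducible κ (L + T) := by
  intro E hE
  obtain ⟨E, F, rfl, hE, hF⟩ := exists_of_map_eq_add hE
  rw [points_add, add_right_comm]
  refine h E (Diagram.points F) hE (by rw [← points_map_rename, hF]) F fun E' hE' => ?_
  rw [add_right_comm, ← points_add]
  exact hR _ (by rw [Multiset.map_add, hE', hF])

theorem ReducesTo.lift {L : Diagram κ} (h : ∀ E P, E.map (rename var) = L →
    InContext (Reducible κ) (E + link κ (E.points + P)) (Completes κ R P)) : L ⇝ᵥ[κ] R :=
  fun _ hR => hR.lift fun E P hE _ => h E P hE

theorem exists_spider_of_map (h : E.map (rename var) = {spider c k A}) :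
    ∃ P, E = {spider c k P} ∧ P.map var = A := by
  obtain ⟨e, rfl, he⟩ := Multiset.map_eq_singleton.1 h
  cases e with
  | spider c' k' P =>
    obtain ⟨rfl, rfl, rfl⟩ := Element.spider.inj he
    exact ⟨P, rfl, rfl⟩
  | had s => cases he
  | star h => cases he
  | edge s => cases he

theorem exists_state_of_map (h : E.map (rename var) = {spider c k {v}}) :
    ∃ p, E = {spider c k {p}} ∧ var p = v := by
  obtain ⟨P, rfl, hP⟩ := exists_spider_of_map h
  obtain ⟨p, rfl, hp⟩ := Multiset.map_eq_singleton.1 hP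
  exact ⟨p, rfl, hp⟩

theorem exists_spider_of_map_pair (h : E.map (rename var) = {spider c k ({a} + {b} + N)}) :
    ∃ p q P, E = {spider c k ({p} + {q} + P)} ∧ var p = a ∧ var q = b ∧ P.map var = N := by
  obtain ⟨P, rfl, hP⟩ := exists_spider_of_map h
  rw [add_assoc] at hP
  obtain ⟨p, P, rfl, hp, hP⟩ := exists_of_map_eq_singleton_add hP
  obtain ⟨q, P, rfl, hq, hP⟩ := exists_of_map_eq_singleton_add hP
  exact ⟨p, q, P, by rw [add_assoc], hp, hq, hP⟩

theorem exists_had_of_map (h : E.map (rename var) = {had s(a, b)}) :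
    ∃ p q, E = {had s(p, q)} ∧ var p = a ∧ var q = b := by
  obtain ⟨e, rfl, he⟩ := Multiset.map_eq_singleton.1 h
  cases e with
  | had s =>
    induction s with | _ p q =>
    rcases Sym2.eq_iff.1 (Element.had.inj he) with ⟨hp, hq⟩ | ⟨hp, hq⟩
    · exact ⟨p, q, rfl, hp, hq⟩
    · exact ⟨q, p, by rw [had_comm], hq, hp⟩
  | spider => cases he
  | star h => cases he
  | edge s => cases he

theorem VarReducible.zero : VarReducible κ 0 := fun E hE => by
  rw [Multiset.map_eq_zero.1 hE]
  exact .zero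

theorem VarReducible.of_phase_zero (hv : v ∈ T.points)
    (h : VarReducible κ ({spider .green 0 {v}} + T)) : VarReducible κ T := by
  rw [← zero_add T]
  refine h.lift fun E P hE hP => ?_
  obtain rfl := Multiset.map_eq_zero.1 hE
  calc
    _ = link κ (0 + P) + 0 := add_comm _ _
    InContext (Reducible κ) _ _ := .detach v (by rwa [zero_add, hP]) (by simp) fun x hx => calc
      _ = {spider .green 0 {x}} + link κ ({x} + P) := by simp only [add_zero]
      InContext (Reducible κ) _ _ := .completes (by simp [rename, hx])

theorem ReducesTo.phase_zero : {spider .green 0 {v}} ⇝ᵥ[κ] 0 := .lift fun E P hE => by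
  obtain ⟨p, rfl, hp⟩ := exists_state_of_map hE
  calc
    {spider .green 0 ({p} + 0)} + link κ ({p} + P) ⇝[κ] link κ (0 + P) := .attach hp (by simp)
    _ = 0 + link κ (0 + P) := (zero_add _).symm
    InContext (Reducible κ) _ _ := .completes rfl

theorem ReducesTo.phase_add_phase :
    {spider .green j {v}} + {spider .green k {v}} ⇝ᵥ[κ] {spider .green (j + k) {v}} :=
  .lift fun E P hE => by
    obtain ⟨E, F, rfl, hE, hF⟩ := exists_of_map_eq_add hE
    obtain ⟨p, rfl, hp⟩ := exists_state_of_map hE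
    obtain ⟨q, rfl, hq⟩ := exists_state_of_map hF
    calc
      _ = link κ ({p} + {q} + P) + ({spider .green j {p}} + {spider .green k {q}}) := add_comm _ _
      InContext (Reducible κ) _ _ := .detach v (by simp [hp]) (by simp [hp, hq]) fun x hx => calc
        _ = {spider .green j ({p} + 0)} + {spider .green 0 ({p} + ({x} + {q}))} +
            {spider .green k {q}} + link κ ({x} + P) := by rw [add_zero]; ac_rfl
        _ ⇝[κ] {spider .green j (0 + ({x} + {q}))} + {spider .green k {q}} +
            link κ ({x} + P) := by
          gcongr ?_ + _ + _; exact .merge_zero p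
        _ = {spider .green j ({q} + {x})} + {spider .green k ({q} + 0)} + link κ ({x} + P) := by
          rw [zero_add, add_zero]; ac_rfl
        _ ⇝[κ] {spider .green (j + k) ({x} + 0)} + link κ ({x} + P) := by
          gcongr ?_ + _; exact .merge q
        InContext (Reducible κ) _ _ := .completes (by simp [rename, hx])

theorem InContext.attach_phase (hp : var p = v) (hA : ∀ a ∈ A, var a = v)
    (h : ∀ x, var x = v →
      InContext (Reducible κ) ({spider .green k {x}} + link κ ({x} + A + P) + K) Q) :
    InContext (Reducible κ) ({spider .green k ({p} + A)} + link κ ({p} + P) + K) Q :=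
  calc
    _ = {spider .green k (0 + ({p} + A))} + (link κ ({p} + P) + K) := by rw [zero_add, add_assoc]
    InContext (Reducible κ) _ Q := .split_zero v fun x hx => calc
      _ = {spider .green k {x}} +
          ({spider .green 0 ({p} + ({x} + A))} + link κ ({p} + P)) + K := by
        rw [add_zero]; ac_rfl
      _ ⇝[κ] {spider .green k {x}} + link κ ({x} + A + P) + K := by
        gcongr _ + ?_ + _; exact .attach hp (by simpa [hx] using hA)
      InContext (Reducible κ) _ Q := h x hx

theorem ReducesTo.phase_add :
    {spider .green (j + k) {v}} ⇝ᵥ[κ] {spider .green j {v}} + {spider .green k {v}} :=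
  .lift fun E P hE => by
    obtain ⟨p, rfl, hp⟩ := exists_state_of_map hE
    calc
      _ = {spider .green (j + k) (0 + {p})} + link κ ({p} + P) := rfl
      InContext (Reducible κ) _ _ := .split v fun x hx => calc
        _ = {spider .green k ({p} + {x})} + link κ ({p} + P) + {spider .green j {x}} := by
          ac_rfl
        InContext (Reducible κ) _ _ := .attach_phase hp (by simpa using hx) fun y hy => calc
          _ = {spider .green j {x}} + {spider .green k {y}} + link κ ({x} + {y} + P) := by ac_rfl
          InContext (Reducible κ) _ _ := .completes (by simp [rename, hx, hy])

theorem ReducesTo.had_self : {had s(v, v)} ⇝ᵥ[κ] {spider .green 2 {v}} := .lift fun E P hE => by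
  obtain ⟨p, q, rfl, hp, hq⟩ := exists_had_of_map hE
  calc
    _ = link κ ({p} + {q} + P) + {had s(p, q)} := add_comm _ _
    InContext (Reducible κ) _ _ := .detach v (by simp [hp]) (by simp [hp, hq]) fun x hx => calc
      _ = {spider .green 0 ({x} + {p} + {q})} + {had s(p, q)} + link κ ({x} + P) := by ac_rfl
      _ ⇝[κ] {spider .green 2 {x}} + link κ ({x} + P) := by gcongr ?_ + _; exact .self_had
      InContext (Reducible κ) _ _ := .completes (by simp [rename, hx])

theorem ReducesTo.var_legless {e : Element κ} (he : e.points = 0) : {e} ⇝ᵥ[κ] 0 :=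
  .lift fun E P hE => by
    obtain ⟨e', rfl, rfl⟩ := Multiset.map_eq_singleton.1 hE
    rw [points_rename, Multiset.map_eq_zero] at he
    rw [points_singleton, he]
    calc
      {e'} + link κ (0 + P) ⇝[κ] 0 + link κ (0 + P) := by gcongr; exact .legless he
      InContext (Reducible κ) _ _ := .completes rfl

theorem exists_edge_of_map (h : E.map (rename var) = {edge s(a, b)}) :
    ∃ p q, E = {edge s(p, q)} ∧ var p = a ∧ var q = b := by
  obtain ⟨e, rfl, he⟩ := Multiset.map_eq_singleton.1 h
  cases e with
  | edge s =>
    induction s with | _ p q =>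
    rcases Sym2.eq_iff.1 (Element.edge.inj he) with ⟨hp, hq⟩ | ⟨hp, hq⟩
    · exact ⟨p, q, rfl, hp, hq⟩
    · exact ⟨q, p, by rw [Sym2.eq_swap], hq, hp⟩
  | spider => cases he
  | had s => cases he
  | star h => cases he

theorem ReducesTo.var_edge : {Element.edge s(a, b)} ⇝ᵥ[κ] {spider .red 0 ({a} + {b})} :=
  .lift fun E P hE => by
    obtain ⟨p, q, rfl, hp, hq⟩ := exists_edge_of_map hE
    calc
      {Element.edge s(p, q)} + link κ ({p} + {q} + P)
      _ ⇝[κ] {spider .red 0 ({p} + {q})} + link κ ({p} + {q} + P) := by gcongr; exact .edge .red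
      InContext (Reducible κ) _ _ := .completes (by simp [rename, hp, hq])

theorem ReducesTo.split_green : {spider .green k ({a} + {b} + N)} ⇝ᵥ[κ]
    {spider .green k ({a} + N)} + {spider .red 0 ({a} + {b})} := .lift fun E P hE => by
  obtain ⟨p, q, A, rfl, hp, hq, hA⟩ := exists_spider_of_map_pair hE
  rw [points_singleton, points_spider]
  calc
    {spider .green k ({p} + {q} + A)} + link κ ({p} + {q} + A + P)
    _ = {spider .green k ({q} + ({p} + A))} + link κ ({p} + ({q} + A + P)) := by ac_rfl
    InContext (Reducible κ) _ _ := .unwire .red a fun x hx => calc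
      _ = {spider .green k (A + ({p} + {x}))} +
          ({spider .red 0 ({x} + {q})} + link κ ({p} + ({q} + A + P))) := by ac_rfl
      InContext (Reducible κ) _ _ := .split_zero a fun y hy => calc
        _ = {spider .green k ({y} + A)} + {spider .red 0 ({x} + {q})} +
            ({spider .green 0 ({p} + ({x} + {y}))} + link κ ({p} + ({q} + A + P))) := by ac_rfl
        _ ⇝[κ] {spider .green k ({y} + A)} + {spider .red 0 ({x} + {q})} +
            link κ ({x} + {y} + ({q} + A + P)) := by
          gcongr _ + ?_; exact .attach hp (by simp [hx, hy])
        _ = {spider .green k ({y} + A)} + {spider .red 0 ({x} + {q})} +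
            link κ ({y} + A + ({x} + {q}) + P) := by ac_rfl
        InContext (Reducible κ) _ _ := .completes (by simp [rename, hx, hy, hq, hA])

theorem ReducesTo.red_hopf : {spider .red k ({v} + {v} + N)} ⇝ᵥ[κ] {spider .red k N} :=
  .lift fun E P hE => by
    obtain ⟨p, q, A, rfl, hp, hq, hA⟩ := exists_spider_of_map_pair hE
    rw [points_singleton, points_spider]
    calc
      _ = link κ ({p} + {q} + (A + P)) + {spider .red k ({p} + {q} + A)} := by ac_rfl
      InContext (Reducible κ) _ _ := .detach v (by simp [hp]) (by simp [hp, hq]) fun x hx => calc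
        _ = {spider .green 0 ({x} + {p} + {q})} + {spider .red k ({p} + {q} + A)} +
            link κ ({x} + (A + P)) := by ac_rfl
        _ ⇝[κ] {spider .green 0 {x}} + {spider .red k A} + link κ ({x} + (A + P)) := by
          gcongr ?_ + _; exact .hopf
        _ = {spider .red k A} + ({spider .green 0 ({x} + 0)} + link κ ({x} + (A + P))) := by
          rw [add_zero]; ac_rfl
        _ ⇝[κ] {spider .red k A} + link κ (0 + (A + P)) := by
          gcongr; exact .attach hx (by simp)
        _ = {spider .red k A} + link κ (A + P) := by rw [zero_add]
        InContext (Reducible κ) _ _ := .completes (by simp [rename, hA])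

theorem ReducesTo.state_odd (hk : k = 1 ∨ k = 3) :
    {spider .red k {v}} ⇝ᵥ[κ] {spider .green (-k) {v}} := .lift fun E P hE => by
  obtain ⟨p, rfl, hp⟩ := exists_state_of_map hE
  calc
    _ = {spider .red k {p}} + link κ ({p} + P) := rfl
    _ ⇝[κ] {spider .green (-k) {p}} + link κ ({p} + P) := by
      gcongr ?_ + _
      rcases hk with rfl | rfl
      · exact .state_one
      · exact .state_three
    InContext (Reducible κ) _ _ := .completes (by simp [rename, hp])

theorem ReducesTo.state_phase (hk : k = 0 ∨ k = 2) :
    {spider .red k {v}} + {spider .green j {v}} ⇝ᵥ[κ] {spider .red k {v}} :=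
  .lift fun E P hE => by
    obtain ⟨E, F, rfl, hE, hF⟩ := exists_of_map_eq_add hE
    obtain ⟨p, rfl, hp⟩ := exists_state_of_map hE
    obtain ⟨q, rfl, hq⟩ := exists_state_of_map hF
    calc
      _ = link κ ({p} + {q} + P) + ({spider .red k {p}} + {spider .green j {q}}) := add_comm _ _
      InContext (Reducible κ) _ _ := .detach v (by simp [hp]) (by simp [hp, hq]) fun x hx => calc
        _ = {spider .red k {p}} + {spider .green 0 ({p} + {q} + {x})} +
            ({spider .green j {q}} + link κ ({x} + P)) := by ac_rfl
        _ ⇝[κ] {spider .red k {q}} + {spider .red k {x}} +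
            ({spider .green j {q}} + link κ ({x} + P)) := by
          gcongr ?_ + _; exact .copy_even hk
        _ = ZX.innerProd κ .green j k q + ({spider .red k {x}} + link κ ({x} + P)) := by
          rw [innerProd_eq, Colour.swap]; ac_rfl
        _ ⇝[κ] 0 + ({spider .red k {x}} + link κ ({x} + P)) := by gcongr ?_ + _; exact .innerProd q
        _ = {spider .red k {x}} + link κ ({x} + P) := zero_add _
        InContext (Reducible κ) _ _ := .completes (by simp [rename, hx])

theorem ReducesTo.state_had (hk : k = 0 ∨ k = 2) :
    {spider .red k {v}} + {had s(v, u)} ⇝ᵥ[κ] {spider .red k {v}} + {spider .green k {u}} :=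
  .lift fun E P hE => by
    obtain ⟨E, F, rfl, hE, hF⟩ := exists_of_map_eq_add hE
    obtain ⟨p, rfl, hp⟩ := exists_state_of_map hE
    obtain ⟨q, n, rfl, hq, hn⟩ := exists_had_of_map hF
    calc
      _ = {spider .red k {p}} + {had s(q, n)} + link κ ({p} + ({q} + {n}) + P) := rfl
      _ = link κ ({p} + {q} + ({n} + P)) + ({spider .red k {p}} + {had s(q, n)}) := by ac_rfl
      InContext (Reducible κ) _ _ := .detach v (by simp [hp]) (by simp [hp, hq]) fun x hx => calc
        _ = {spider .red k {p}} + {spider .green 0 ({p} + {q} + {x})} +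
            ({had s(q, n)} + link κ ({x} + ({n} + P))) := by ac_rfl
        _ ⇝[κ] {spider .red k {q}} + {spider .red k {x}} +
            ({had s(q, n)} + link κ ({x} + ({n} + P))) := by
          gcongr ?_ + _; exact .copy_even hk
        _ = {spider .red k {q}} + {had s(q, n)} +
            ({spider .red k {x}} + link κ ({x} + {n} + P)) := by ac_rfl
        _ ⇝[κ] {spider .green k {n}} + ({spider .red k {x}} + link κ ({x} + {n} + P)) := by
          gcongr ?_ + _; exact .state_through_had
        _ = {spider .red k {x}} + {spider .green k {n}} + link κ ({x} + {n} + P) := by ac_rfl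
        InContext (Reducible κ) _ _ := .completes (by simp [rename, hx, hn])

end Variables

section Sums

variable {κ : Calculus} {c : Colour} {k : ZMod 4} {a b d n p q r s v : ℕ} {N P : Multiset ℕ}
  {E K T : Diagram κ} {Q : Diagram κ → Prop}

theorem InContext.distribute (hp : var p = a) (hq : var q = b) (hr : var r = d) (hs : var s = d)
    (h : ∀ w x y z t, var w = a → var x = a → var y = b → var z = b → var t = d →
      InContext (Reducible κ) ({spider .red 0 ({s} + ({w} + {y}))} +
        {spider .red 0 ({x} + {z} + {t})} + link κ ({w} + {x} + {y} + {z} + {t} + P) + K) Q) :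
    InContext (Reducible κ)
      ({spider .red 0 ({p} + {q} + {r})} + link κ ({p} + {q} + {r} + {s} + P) + K) Q :=
  calc
    _ = link κ ({r} + {s} + ({p} + {q} + P)) + ({spider .red 0 ({p} + {q} + {r})} + K) := by ac_rfl
    InContext (Reducible κ) _ Q := .detach d (by simp [hr]) (by simp [hr, hs]) fun t ht => calc
      _ = {spider Colour.green.swap 0 ({p} + {q} + {r})} + {spider .green 0 ({r} + {s} + {t})} +
          (link κ ({t} + ({p} + {q} + P)) + K) := by rw [Colour.swap]; ac_rfl
      InContext (Reducible κ) _ Q := .unbialgebra a b fun w x y z hw hx hy hz => calc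
        _ = {spider .green 0 ({p} + ({w} + {x}))} + link κ ({p} + ({q} + {t} + P)) +
            {spider .green 0 ({q} + ({y} + {z}))} +
            ({spider .red 0 ({s} + ({w} + {y}))} + {spider .red 0 ({x} + {z} + {t})} + K) := by
          rw [Colour.swap]; ac_rfl
        _ ⇝[κ] link κ ({w} + {x} + ({q} + {t} + P)) + {spider .green 0 ({q} + ({y} + {z}))} +
            ({spider .red 0 ({s} + ({w} + {y}))} + {spider .red 0 ({x} + {z} + {t})} + K) := by
          gcongr ?_ + _ + _; exact .attach hp (by simp [hw, hx])
        _ = {spider .green 0 ({q} + ({y} + {z}))} + link κ ({q} + ({w} + {x} + {t} + P)) +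
            ({spider .red 0 ({s} + ({w} + {y}))} + {spider .red 0 ({x} + {z} + {t})} + K) := by
          ac_rfl
        _ ⇝[κ] link κ ({y} + {z} + ({w} + {x} + {t} + P)) +
            ({spider .red 0 ({s} + ({w} + {y}))} + {spider .red 0 ({x} + {z} + {t})} + K) := by
          gcongr ?_ + _; exact .attach hq (by simp [hy, hz])
        _ = {spider .red 0 ({s} + ({w} + {y}))} + {spider .red 0 ({x} + {z} + {t})} +
            link κ ({w} + {x} + {y} + {z} + {t} + P) + K := by ac_rfl
        InContext (Reducible κ) _ Q := h w x y z t hw hx hy hz ht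

theorem exists_sum_of_map (h : E.map (rename var) = {spider c k ({a} + {b} + {d})}) :
    ∃ p q r, E = {spider c k ({p} + {q} + {r})} ∧ var p = a ∧ var q = b ∧ var r = d := by
  obtain ⟨p, q, P, rfl, hp, hq, hP⟩ := exists_spider_of_map_pair h
  obtain ⟨r, rfl, hr⟩ := Multiset.map_eq_singleton.1 hP
  exact ⟨p, q, r, rfl, hp, hq, hr⟩

theorem ReducesTo.sum_had : {spider .red 0 ({a} + {b} + {d})} + {had s(d, n)} ⇝ᵥ[κ]
    {spider .red 0 ({a} + {b} + {d})} + ({had s(a, n)} + {had s(b, n)}) := .lift fun E P hE => by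
  obtain ⟨E, F, rfl, hE, hF⟩ := exists_of_map_eq_add hE
  obtain ⟨p, q, r, rfl, hp, hq, hr⟩ := exists_sum_of_map hE
  obtain ⟨s, m, rfl, hs, hm⟩ := exists_had_of_map hF
  rw [points_add, points_singleton, points_singleton, points_spider, points_had]
  calc
    _ = {spider .red 0 ({p} + {q} + {r})} + link κ ({p} + {q} + {r} + {s} + ({m} + P)) +
        {had s(s, m)} := by ac_rfl
    InContext (Reducible κ) _ _ := .distribute hp hq hr hs fun w x y z t hw hx hy hz ht => calc
      _ = {spider .red 0 ({s} + ({w} + {y}))} + {had s(s, m)} +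
          ({spider .red 0 ({x} + {z} + {t})} +
            link κ ({m} + ({w} + {x} + {y} + {z} + {t} + P))) := by ac_rfl
      InContext (Reducible κ) _ _ := .push_had n fun M hM hn => by
        obtain ⟨w', M, rfl, hM'⟩ := exists_pair_of_map_fst hM
        obtain ⟨y', rfl⟩ := exists_eq_singleton_of_map_fst hM'
        have hw' : var w' = n := hn (w, w') (by simp)
        have hy' : var y' = n := hn (y, y') (by simp)
        calc
          _ = {spider .red 0 ({x} + {z} + {t})} + ({had s(w, w')} + {had s(y, y')}) +
              ({spider .green 0 ({m} + ({w'} + {y'}))} +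
                link κ ({m} + ({w} + {x} + {y} + {z} + {t} + P))) := by
            simp only [Multiset.map_add, Multiset.map_singleton, hads_add, hads_singleton,
              Colour.swap]
            ac_rfl
          _ ⇝[κ] {spider .red 0 ({x} + {z} + {t})} + ({had s(w, w')} + {had s(y, y')}) +
              link κ ({w'} + {y'} + ({w} + {x} + {y} + {z} + {t} + P)) := by
            gcongr _ + ?_; exact .attach hm (by simp [hw', hy'])
          _ = {spider .red 0 ({x} + {z} + {t})} + ({had s(w, w')} + {had s(y, y')}) +
              link κ ({x} + {z} + {t} + ({w} + {w'} + ({y} + {y'})) + P) := by ac_rfl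
          InContext (Reducible κ) _ _ := .completes (by simp [rename, *])

theorem ReducesTo.sum_phase_one : {spider .red 0 ({a} + {b} + {d})} + {spider .green 1 {d}} ⇝ᵥ[κ]
    {spider .red 0 ({a} + {b} + {d})} +
      ({spider .green 1 {a}} + {spider .green 1 {b}} + {had s(a, b)}) := .lift fun E P hE => by
  obtain ⟨E, F, rfl, hE, hF⟩ := exists_of_map_eq_add hE
  obtain ⟨p, q, r, rfl, hp, hq, hr⟩ := exists_sum_of_map hE
  obtain ⟨s, rfl, hs⟩ := exists_state_of_map hF
  rw [points_add, points_singleton, points_singleton, points_spider, points_spider]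
  calc
    _ = {spider .red 0 ({p} + {q} + {r})} + link κ ({p} + {q} + {r} + {s} + P) +
        {spider Colour.red.swap 1 {s}} := by rw [Colour.swap]; ac_rfl
    InContext (Reducible κ) _ _ := .distribute hp hq hr hs fun w x y z t hw hx hy hz ht => calc
      _ ⇝[κ] {spider .red 0 ({s} + ({w} + {y}))} + {spider .red 0 ({x} + {z} + {t})} +
          link κ ({w} + {x} + {y} + {z} + {t} + P) + {spider .red 3 {s}} := by
        gcongr; exact .state_one
      _ = {spider .red 3 ({s} + 0)} + {spider .red 0 ({s} + ({w} + {y}))} +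
          ({spider .red 0 ({x} + {z} + {t})} + link κ ({w} + {x} + {y} + {z} + {t} + P)) := by
        rw [add_zero]; ac_rfl
      _ ⇝[κ] {spider .red 3 (0 + ({w} + {y}))} +
          ({spider .red 0 ({x} + {z} + {t})} + link κ ({w} + {x} + {y} + {z} + {t} + P)) := by
        gcongr ?_ + _; exact .merge_zero s
      _ = {spider Colour.green.swap 3 ({w} + {y})} +
          ({spider .red 0 ({x} + {z} + {t})} + link κ ({w} + {x} + {y} + {z} + {t} + P)) := by
        rw [zero_add]; rfl
      InContext (Reducible κ) _ _ := .wire_three a b fun w' y' hw' hy' => calc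
        _ = {spider .green 1 ({w} + {w'})} + link κ ({w} + ({x} + {y} + {z} + {t} + P)) +
            ({spider .green 1 ({y} + {y'})} + {had s(w', y')} +
              {spider .red 0 ({x} + {z} + {t})}) := by ac_rfl
        InContext (Reducible κ) _ _ := .attach_phase hw (by simpa) fun w hw => calc
          _ = {spider .green 1 ({y} + {y'})} + link κ ({y} + ({w} + {w'} + {x} + {z} + {t} + P)) +
              ({spider .green 1 {w}} + {had s(w', y')} +
                {spider .red 0 ({x} + {z} + {t})}) := by ac_rfl
          InContext (Reducible κ) _ _ := .attach_phase hy (by simpa) fun y hy => calc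
            _ = {spider .red 0 ({x} + {z} + {t})} +
                ({spider .green 1 {w}} + {spider .green 1 {y}} + {had s(w', y')}) +
                link κ ({x} + {z} + {t} + ({w} + {y} + ({w'} + {y'})) + P) := by ac_rfl
            InContext (Reducible κ) _ _ := .completes (by simp [rename, *])

theorem VarReducible.split_red (hA : v ∉ N) (hT : v ∉ T.points) (ha : v ≠ a) (hb : v ≠ b)
    (h : VarReducible κ
      ({spider .red 0 ({a} + {b} + {v})} + {spider .red k ({v} + N)} + T)) :
    VarReducible κ ({spider .red k ({a} + {b} + N)} + T) :=
  h.lift fun E P hE hP => by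
    obtain ⟨p, q, A, rfl, rfl, rfl, rfl⟩ := exists_spider_of_map_pair hE
    rw [points_singleton, points_spider]
    calc
      _ = {spider .red k (A + ({p} + {q}))} + link κ ({p} + {q} + A + P) := by ac_rfl
      InContext (Reducible κ) _ _ := .split_zero v fun x hx => calc
        _ = {spider .red 0 ({x} + ({p} + {q}))} +
            ({spider .red k ({x} + A)} + link κ ({p} + {q} + A + P)) := by ac_rfl
        InContext (Reducible κ) _ _ := .unwire .green v fun y hy => calc
          _ = {spider .red 0 ({p} + {q} + {y})} + {spider .red k ({x} + A)} +
              ({spider .green 0 ({y} + {x})} + link κ ({p} + {q} + A + P)) := by ac_rfl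
          _ = {spider .red 0 ({p} + {q} + {y})} + {spider .red k ({x} + A)} +
              link κ ({y} + {x} + ({p} + {q} + A + P)) := by
            rw [link_add_eq_of_notMem (A := {y} + {x}) (v := v) (by simp) (by simp [hx, hy])]
            simpa [ha, hb, hP, hT] using hA
          _ = {spider .red 0 ({p} + {q} + {y})} + {spider .red k ({x} + A)} +
              link κ ({p} + {q} + {y} + ({x} + A) + P) := by ac_rfl
          InContext (Reducible κ) _ _ := .completes (by simp [rename, *])

theorem VarReducible.of_sum (ha : v ≠ a) (hb : v ≠ b) (hT : v ∉ T.points)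
    (h : VarReducible κ T) : VarReducible κ ({spider .red 0 ({a} + {b} + {v})} + T) := by
  suffices VarReducible κ ({spider .green 0 {a}} + {spider .green 0 {b}} + T) from
    this.lift fun E P hE hP => by
      obtain ⟨p, q, r, rfl, rfl, rfl, hr⟩ := exists_sum_of_map hE
      rw [points_singleton, points_spider]
      calc
        _ = {spider .red 0 ({p} + {q} + {r})} + link κ ({r} + ({p} + {q} + P)) := by ac_rfl
        _ = {spider .green 0 {r}} + {spider Colour.green.swap 0 ({r} + {p} + {q})} +
            link κ ({p} + {q} + P) := by
          rw [link_add_eq_of_notMem (v := v) (by simp) (by simp [hr]) (by simp [ha, hb, hP, hT]),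
            Colour.swap]
          ac_rfl
        _ ⇝[κ] {spider .green 0 {p}} + {spider .green 0 {q}} + link κ ({p} + {q} + P) := by
          gcongr ?_ + _; exact .copy_swap
        InContext (Reducible κ) _ _ := .completes (by simp [rename])
  have h' : {spider .green 0 {a}} + {spider .green 0 {b}} + T ⇝ᵥ[κ] 0 + 0 + T := by
    gcongr <;> exact .phase_zero
  exact h'.elim (by rwa [zero_add, zero_add])

theorem VarReducible.of_state (hT : v ∉ T.points) (h : VarReducible κ T) :
    VarReducible κ ({spider .red k {v}} + T) :=
  VarReducible.lift (R := 0) (by rwa [zero_add]) fun E P hE hP => by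
    obtain ⟨p, rfl, hp⟩ := exists_state_of_map hE
    calc
      {spider .red k {p}} + link κ ({p} + P)
      _ = innerProd κ .green 0 k p + link κ (0 + P) := by
        rw [link_add_eq_of_notMem (v := v) (by simp) (by simp [hp]) (by rwa [hP]), zero_add,
          innerProd_eq, Colour.swap]
        ac_rfl
      _ ⇝[κ] 0 + link κ (0 + P) := by gcongr; exact .innerProd p
      InContext (Reducible κ) _ _ := .completes rfl rfl

end Sums

section Fans

variable {κ : Calculus} {k : ZMod 4} {a b d p v : ℕ} {A : Multiset ℕ} {E T : Diagram κ}

/-- Hadamard nodes between the point `v` and each member of `A`. -/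
def fan (κ : Calculus) (v : ℕ) (A : Multiset ℕ) : Diagram κ := hads κ (A.map (·, v))

@[simp] theorem fan_add (A B : Multiset ℕ) : fan κ v (A + B) = fan κ v A + fan κ v B := by
  rw [fan, Multiset.map_add, hads_add, fan, fan]

@[simp] theorem fan_singleton : fan κ v {a} = {had s(a, v)} := rfl

theorem map_rename_var_hads {M : Multiset (ℕ × ℕ)} (hM : ∀ m ∈ M, var m.2 = v) :
    (hads κ M).map (rename var) = fan κ v ((M.map Prod.fst).map var) := by
  simp only [fan, hads, Multiset.map_map]
  exact Multiset.map_congr rfl fun m hm => by simp [rename, hM m hm]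

theorem exists_hads_of_map (h : E.map (rename var) = fan κ v A) :
    ∃ M : Multiset (ℕ × ℕ), E = hads κ M ∧ (M.map Prod.fst).map var = A ∧
      ∀ m ∈ M, var m.2 = v := by
  induction A using Multiset.induction generalizing E with
  | empty => exact ⟨0, Multiset.map_eq_zero.1 h, rfl, by simp⟩
  | cons a A ih =>
    rw [← Multiset.singleton_add, fan_add, fan_singleton] at h
    obtain ⟨E, F, rfl, hE, hF⟩ := exists_of_map_eq_add h
    obtain ⟨p, q, rfl, rfl, hq⟩ := exists_had_of_map hE
    obtain ⟨M, rfl, rfl, hM⟩ := ih hF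
    exact ⟨{(p, q)} + M, by rw [hads_add, hads_singleton], by simp, by simpa [hq] using hM⟩

theorem var_eq_of_mem_add_map_snd {M : Multiset (ℕ × ℕ)} (hM : ∀ m ∈ M, var m.2 = v)
    (hp : var p = v) : ∀ a ∈ {p} + M.map Prod.snd, var a = v := by
  simpa [hp] using fun a b h => hM (b, a) h

theorem VarReducible.of_red (hA : v ∉ A) (hT : v ∉ T.points)
    (h : VarReducible κ ({spider .red k A} + T)) :
    VarReducible κ ({spider .green k {v}} + fan κ v A + T) :=
  h.lift fun E P hE hP => by
    obtain ⟨E, F, rfl, hE, hF⟩ := exists_of_map_eq_add hE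
    obtain ⟨p, rfl, hp⟩ := exists_state_of_map hE
    obtain ⟨M, rfl, rfl, hM⟩ := exists_hads_of_map hF
    rw [points_add, points_singleton, points_spider, points_hads]
    calc
      _ = {spider .green k {p}} + hads κ M +
          link κ ({p} + M.map Prod.snd + (M.map Prod.fst + P)) := by ac_rfl
      _ = {spider .green k ({p} + 0)} + {spider .green 0 ({p} + M.map Prod.snd)} + hads κ M +
          link κ (M.map Prod.fst + P) := by
        rw [link_add_eq_of_notMem (by simp) (var_eq_of_mem_add_map_snd hM hp), add_zero]
        · ac_rfl
        · rw [Multiset.map_add, hP, Multiset.mem_add, not_or]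
          exact ⟨hA, hT⟩
      _ ⇝[κ] {spider .green k (0 + M.map Prod.snd)} + hads κ M + link κ (M.map Prod.fst + P) := by
        gcongr ?_ + _ + _; exact .merge_zero p
      _ = {spider Colour.red.swap k (M.map Prod.snd)} + hads κ M +
          link κ (M.map Prod.fst + P) := by rw [zero_add, Colour.swap]
      _ ⇝[κ] {spider .red k (M.map Prod.fst)} + link κ (M.map Prod.fst + P) := by
        gcongr ?_ + _; exact .uncolour M
      InContext (Reducible κ) _ _ := .completes (by simp [rename])

theorem VarReducible.of_phase_add_fan (hA : v ∉ A) (hT : v ∉ T.points)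
    (h : VarReducible κ ({spider .green k {v}} + fan κ v A + T)) :
    VarReducible κ ({spider .red k A} + T) :=
  h.lift fun E P hE hP => by
    obtain ⟨N, rfl, rfl⟩ := exists_spider_of_map hE
    rw [points_singleton, points_spider]
    refine .colour v fun M hN hM => ?_
    subst hN
    calc
      _ = {spider .green k (0 + M.map Prod.snd)} +
          (hads κ M + link κ (M.map Prod.fst + P)) := by rw [zero_add, add_assoc]; rfl
      InContext (Reducible κ) _ _ := .split_zero v fun p hp => calc
        _ = {spider .green k {p}} + hads κ M +
            ({spider .green 0 ({p} + M.map Prod.snd)} + link κ (M.map Prod.fst + P)) := by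
          rw [add_zero]; ac_rfl
        _ = {spider .green k {p}} + hads κ M +
            link κ ({p} + M.map Prod.snd + (M.map Prod.fst + P)) := by
          rw [link_add_eq_of_notMem (by simp) (var_eq_of_mem_add_map_snd hM hp)]
          rw [Multiset.map_add, hP, Multiset.mem_add, not_or]
          exact ⟨hA, hT⟩
        _ = {spider .green k {p}} + hads κ M +
            link κ ({p} + (M.map Prod.fst + M.map Prod.snd) + P) := by ac_rfl
        InContext (Reducible κ) _ _ :=
          .completes (by simp [rename, hp, map_rename_var_hads hM])
            (by simp [-Multiset.singleton_add])

theorem ReducesTo.sum_fan : {spider .red 0 ({a} + {b} + {d})} + fan κ d A ⇝ᵥ[κ]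
    {spider .red 0 ({a} + {b} + {d})} + (fan κ a A + fan κ b A) := by
  induction A using Multiset.induction with
  | empty => rfl
  | cons n A ih =>
    simp only [← Multiset.singleton_add, fan_add, fan_singleton, had_comm n]
    calc
      _ = {spider .red 0 ({a} + {b} + {d})} + {had s(d, n)} + fan κ d A := by ac_rfl
      _ ⇝ᵥ[κ] {spider .red 0 ({a} + {b} + {d})} + ({had s(a, n)} + {had s(b, n)}) +
          fan κ d A := by gcongr ?_ + _; exact .sum_had
      _ = {spider .red 0 ({a} + {b} + {d})} + fan κ d A +
          ({had s(a, n)} + {had s(b, n)}) := by ac_rfl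
      _ ⇝ᵥ[κ] {spider .red 0 ({a} + {b} + {d})} + (fan κ a A + fan κ b A) +
          ({had s(a, n)} + {had s(b, n)}) := by gcongr ?_ + _
      _ = _ := by ac_rfl

theorem ReducesTo.sum_phase (n : ℕ) :
    {spider .red 0 ({a} + {b} + {d})} + {spider .green n {d}} ⇝ᵥ[κ]
      {spider .red 0 ({a} + {b} + {d})} +
        n • ({spider .green 1 {a}} + {spider .green 1 {b}} + {had s(a, b)}) := by
  induction n with
  | zero =>
    rw [Nat.cast_zero, zero_smul]
    gcongr; exact .phase_zero
  | succ n ih =>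
    rw [Nat.cast_succ, succ_nsmul]
    calc
      _ ⇝ᵥ[κ] {spider .red 0 ({a} + {b} + {d})} +
          ({spider .green n {d}} + {spider .green 1 {d}}) := by gcongr; exact .phase_add
      _ = {spider .red 0 ({a} + {b} + {d})} + {spider .green n {d}} +
          {spider .green 1 {d}} := (add_assoc _ _ _).symm
      _ ⇝ᵥ[κ] {spider .red 0 ({a} + {b} + {d})} +
          n • ({spider .green 1 {a}} + {spider .green 1 {b}} + {had s(a, b)}) +
          {spider .green 1 {d}} := by gcongr ?_ + _
      _ = {spider .red 0 ({a} + {b} + {d})} + {spider .green 1 {d}} +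
          n • ({spider .green 1 {a}} + {spider .green 1 {b}} + {had s(a, b)}) := by ac_rfl
      _ ⇝ᵥ[κ] {spider .red 0 ({a} + {b} + {d})} +
          ({spider .green 1 {a}} + {spider .green 1 {b}} + {had s(a, b)}) +
          n • ({spider .green 1 {a}} + {spider .green 1 {b}} + {had s(a, b)}) := by
        gcongr ?_ + _; exact .sum_phase_one
      _ = _ := by ac_rfl

theorem ReducesTo.state_fan (hk : k = 0 ∨ k = 2) :
    {spider .red k {v}} + fan κ v A ⇝ᵥ[κ]
      {spider .red k {v}} + A.map fun a => spider .green k {a} := by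
  induction A using Multiset.induction with
  | empty => rfl
  | cons a A ih =>
    simp only [← Multiset.singleton_add, fan_add, fan_singleton, had_comm a, Multiset.map_add,
      Multiset.map_singleton]
    calc
      _ = {spider .red k {v}} + {had s(v, a)} + fan κ v A := by ac_rfl
      _ ⇝ᵥ[κ] {spider .red k {v}} + {spider .green k {a}} + fan κ v A := by
        gcongr ?_ + _; exact .state_had hk
      _ = {spider .red k {v}} + fan κ v A + {spider .green k {a}} := by ac_rfl
      _ ⇝ᵥ[κ] {spider .red k {v}} + (A.map fun a => spider .green k {a}) +
          {spider .green k {a}} := by gcongr ?_ + _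
      _ = _ := by ac_rfl

end Fans

section Elimination

variable {κ : Calculus} {k : ZMod 4} {a b v w : ℕ} {A N : Multiset ℕ} {R T U : Diagram κ}
  {V V' : Finset ℕ}

theorem eq_zero_or_singleton_or_pair {α : Type*} (N : Multiset α) :
    N = 0 ∨ (∃ a, N = {a}) ∨ ∃ a b N', N = {a} + {b} + N' := by
  induction N using Multiset.induction with
  | empty => exact .inl rfl
  | cons a N _ =>
    induction N using Multiset.induction with
    | empty => exact .inr (.inl ⟨a, rfl⟩)
    | cons b N _ => exact .inr (.inr ⟨a, b, N, (add_assoc {a} {b} N).symm⟩)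

/-- Diagrams whose points are variables in `V` and that consist of one-legged green nodes, which
stand for phases of variables, and Hadamard nodes between variables. -/
def GraphLike (V : Finset ℕ) (T : Diagram κ) : Prop :=
  ∀ e ∈ T, (∃ k, ∃ v ∈ V, e = spider .green k {v}) ∨ ∃ v ∈ V, ∃ w ∈ V, e = had s(v, w)

namespace GraphLike

theorem zero : GraphLike V (0 : Diagram κ) := fun _ h => absurd h (Multiset.notMem_zero _)

theorem phase (hv : v ∈ V) : GraphLike V ({spider .green k {v}} : Diagram κ) := fun _ h =>
  .inl ⟨k, v, hv, Multiset.mem_singleton.1 h⟩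

theorem had (hv : v ∈ V) (hw : w ∈ V) : GraphLike V ({had s(v, w)} : Diagram κ) := fun _ h =>
  .inr ⟨v, hv, w, hw, Multiset.mem_singleton.1 h⟩

theorem add (hT : GraphLike V T) (hU : GraphLike V U) : GraphLike V (T + U) := fun e h =>
  (Multiset.mem_add.1 h).elim (hT e) (hU e)

theorem nsmul (hT : GraphLike V T) (n : ℕ) : GraphLike V (n • T) := fun e h =>
  hT e (Multiset.mem_of_mem_nsmul h)

theorem phases (hA : ∀ a ∈ A, a ∈ V) :
    GraphLike V (A.map fun a => spider .green k {a} : Diagram κ) := fun _ h =>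
  let ⟨a, ha, he⟩ := Multiset.mem_map.1 h
  .inl ⟨k, a, hA a ha, he.symm⟩

theorem fan (hv : v ∈ V) (hA : ∀ a ∈ A, a ∈ V) : GraphLike V (fan κ v A) := fun e h => by
  rw [ZX.fan, hads, Multiset.map_map, Multiset.mem_map] at h
  obtain ⟨a, ha, rfl⟩ := h
  exact .inr ⟨a, hA a ha, v, hv, rfl⟩

theorem mono (hT : GraphLike V T) (h : V ⊆ V') : GraphLike V' T := fun e he =>
  (hT e he).imp (fun ⟨k, v, hv, he⟩ => ⟨k, v, h hv, he⟩)
    fun ⟨v, hv, w, hw, he⟩ => ⟨v, h hv, w, h hw, he⟩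

theorem notMem_points (hT : GraphLike V T) (hv : v ∉ V) : v ∉ T.points := fun h => by
  obtain ⟨e, he, hve⟩ := Multiset.mem_bind.1 h
  obtain ⟨k, w, hw, rfl⟩ | ⟨w, hw, x, hx, rfl⟩ := hT e he
  · rw [points_spider, Multiset.mem_singleton] at hve
    exact hv (hve ▸ hw)
  · rw [points_had, Multiset.mem_add, Multiset.mem_singleton, Multiset.mem_singleton] at hve
    rcases hve with rfl | rfl
    exacts [hv hw, hv hx]

theorem isolate_add {e : Element κ} {W : Diagram κ} (hA : ∀ a ∈ A, a ∈ V) (hW : GraphLike V W)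
    (he : (∃ k, ∃ w ∈ insert v V, e = spider .green k {w}) ∨
      ∃ w ∈ insert v V, ∃ x ∈ insert v V, e = Element.had s(w, x)) :
    ∃ j B X, (∀ b ∈ B, b ∈ V) ∧ GraphLike V X ∧
      {spider .green k {v}} + ZX.fan κ v A + W + {e} ⇝ᵥ[κ]
        {spider .green j {v}} + ZX.fan κ v B + X := by
  have phase (j : ZMod 4) : {spider .green k {v}} + ZX.fan κ v A + W + {spider .green j {v}} ⇝ᵥ[κ]
      {spider .green (k + j) {v}} + ZX.fan κ v A + W := calc
    _ = {spider .green k {v}} + {spider .green j {v}} + (ZX.fan κ v A + W) := by ac_rfl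
    _ ⇝ᵥ[κ] {spider .green (k + j) {v}} + (ZX.fan κ v A + W) := by
      gcongr ?_ + _; exact .phase_add_phase
    _ = {spider .green (k + j) {v}} + ZX.fan κ v A + W := (add_assoc _ _ _).symm
  have had_var (a : ℕ) : {spider .green k {v}} + ZX.fan κ v A + W + {Element.had s(a, v)} ⇝ᵥ[κ]
      {spider .green k {v}} + ZX.fan κ v (A + {a}) + W := .of_eq <| by
    rw [fan_add, fan_singleton]
    ac_rfl
  have hadd (a : ℕ) (ha : a ∈ V) : ∀ b ∈ A + {a}, b ∈ V := by
    simpa [or_imp, forall_and] using ⟨hA, ha⟩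
  simp only [Finset.mem_insert] at he
  obtain ⟨j, w, rfl | hw, rfl⟩ | ⟨w, rfl | hw, x, rfl | hx, rfl⟩ := he
  · exact ⟨k + j, A, W, hA, hW, phase j⟩
  · exact ⟨k, A, W + {spider .green j {w}}, hA, hW.add (.phase hw), .of_eq (add_assoc _ _ _)⟩
  · refine ⟨k + 2, A, W, hA, hW, .trans ?_ (phase 2)⟩
    gcongr
    exact .had_self
  · exact ⟨k, A + {x}, W, hadd x hx, hW, by rw [had_comm]; exact had_var x⟩
  · exact ⟨k, A + {w}, W, hadd w hw, hW, by exact had_var w⟩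
  · exact ⟨k, A, W + {Element.had s(w, x)}, hA, hW.add (.had hw hx), .of_eq (add_assoc _ _ _)⟩

theorem isolate (hT : GraphLike (insert v V) T) :
    ∃ k A W, (∀ a ∈ A, a ∈ V) ∧ GraphLike V W ∧
      {spider .green 0 {v}} + T ⇝ᵥ[κ] {spider .green k {v}} + ZX.fan κ v A + W := by
  induction T using Multiset.induction with
  | empty => exact ⟨0, 0, 0, by simp, zero, .of_eq rfl⟩
  | cons e T ih =>
    obtain ⟨k, A, W, hA, hW, h⟩ := ih fun e he => hT e (Multiset.mem_cons_of_mem he)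
    obtain ⟨j, B, X, hB, hX, h'⟩ := isolate_add (k := k) hA hW (hT e (Multiset.mem_cons_self e T))
    exact ⟨j, B, X, hB, hX, calc
      _ = {spider .green 0 {v}} + T + {e} := by rw [← Multiset.singleton_add]; ac_rfl
      _ ⇝ᵥ[κ] {spider .green k {v}} + ZX.fan κ v A + W + {e} := by gcongr
      _ ⇝ᵥ[κ] _ := h'⟩

theorem substitute (hU : GraphLike (insert v V) U) (hv : v ∉ V) (ha : a ∈ V) (hb : b ∈ V)
    (hR : v ∉ R.points) (h : ∀ T, GraphLike V T → VarReducible κ (R + T)) :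
    VarReducible κ ({spider .red 0 ({a} + {b} + {v})} + (R + U)) := by
  obtain ⟨k, A, W, hA, hW, hUW⟩ := hU.isolate
  have hphase : {spider .red 0 ({a} + {b} + {v})} + {spider .green k {v}} ⇝ᵥ[κ]
      {spider .red 0 ({a} + {b} + {v})} +
        k.val • ({spider .green 1 {a}} + {spider .green 1 {b}} + {Element.had s(a, b)}) := by
    simpa only [ZMod.natCast_val, ZMod.cast_id] using ReducesTo.sum_phase k.val
  set G : Diagram κ :=
    k.val • ({spider .green 1 {a}} + {spider .green 1 {b}} + {Element.had s(a, b)})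
  have hT : GraphLike V (W + G + (ZX.fan κ a A + ZX.fan κ b A)) :=
    (hW.add (.nsmul (.add (.add (.phase ha) (.phase hb)) (.had ha hb)) _)).add
      (.add (.fan ha hA) (.fan hb hA))
  have hred : {spider .green 0 {v}} + ({spider .red 0 ({a} + {b} + {v})} + (R + U)) ⇝ᵥ[κ]
      {spider .red 0 ({a} + {b} + {v})} + (R + (W + G + (ZX.fan κ a A + ZX.fan κ b A))) := calc
    _ = {spider .red 0 ({a} + {b} + {v})} + R + ({spider .green 0 {v}} + U) := by ac_rfl
    _ ⇝ᵥ[κ] {spider .red 0 ({a} + {b} + {v})} + R +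
        ({spider .green k {v}} + ZX.fan κ v A + W) := by gcongr
    _ = {spider .red 0 ({a} + {b} + {v})} + {spider .green k {v}} +
        (R + W + ZX.fan κ v A) := by ac_rfl
    _ ⇝ᵥ[κ] {spider .red 0 ({a} + {b} + {v})} + G + (R + W + ZX.fan κ v A) := by
      gcongr ?_ + _
    _ = {spider .red 0 ({a} + {b} + {v})} + ZX.fan κ v A + (R + W + G) := by ac_rfl
    _ ⇝ᵥ[κ] {spider .red 0 ({a} + {b} + {v})} + (ZX.fan κ a A + ZX.fan κ b A) +
        (R + W + G) := by gcongr ?_ + _; exact .sum_fan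
    _ = _ := by ac_rfl
  refine .of_phase_zero (v := v) (by simp [-Multiset.singleton_add])
    (hred.elim (.of_sum ?_ ?_ ?_ (h _ hT)))
  · exact fun h => hv (h ▸ ha)
  · exact fun h => hv (h ▸ hb)
  · rw [points_add, Multiset.mem_add, not_or]
    exact ⟨hR, hT.notMem_points hv⟩

theorem specialize (hU : GraphLike (insert v V) U) (hv : v ∉ V) (hk : k = 0 ∨ k = 2)
    (h : ∀ T, GraphLike V T → VarReducible κ T) :
    VarReducible κ ({spider .red k {v}} + U) := by
  obtain ⟨j, A, W, hA, hW, hUW⟩ := hU.isolate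
  have hT : GraphLike V ((A.map fun a => spider .green k {a}) + W) := .add (.phases hA) hW
  have hred : {spider .green 0 {v}} + ({spider .red k {v}} + U) ⇝ᵥ[κ]
      {spider .red k {v}} + ((A.map fun a => spider .green k {a}) + W) := calc
    _ = {spider .red k {v}} + ({spider .green 0 {v}} + U) := add_left_comm _ _ _
    _ ⇝ᵥ[κ] {spider .red k {v}} + ({spider .green j {v}} + ZX.fan κ v A + W) := by gcongr
    _ = {spider .red k {v}} + {spider .green j {v}} + (ZX.fan κ v A + W) := by ac_rfl
    _ ⇝ᵥ[κ] {spider .red k {v}} + (ZX.fan κ v A + W) := by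
      gcongr ?_ + _; exact .state_phase hk
    _ = {spider .red k {v}} + ZX.fan κ v A + W := (add_assoc _ _ _).symm
    _ ⇝ᵥ[κ] {spider .red k {v}} + (A.map fun a => spider .green k {a}) + W := by
      gcongr ?_ + _; exact .state_fan hk
    _ = _ := add_assoc _ _ _
  exact .of_phase_zero (v := v) (by simp [-Multiset.singleton_add])
    (hred.elim (.of_state (hT.notMem_points hv) (h _ hT)))

theorem red_odd {V : Finset ℕ} {N : Multiset ℕ} {R T : Diagram κ} (hT : GraphLike V T)
    (hk : k = 1 ∨ k = 3) (hN : ∀ n ∈ N, n ∈ V)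
    (h : ∀ T, GraphLike V T → VarReducible κ (R + T)) :
    VarReducible κ ({spider .red k N} + (R + T)) := by
  obtain rfl | ⟨a, rfl⟩ | ⟨a, b, N, rfl⟩ := eq_zero_or_singleton_or_pair N
  · have hred : {spider .red k 0} + (R + T) ⇝ᵥ[κ] 0 + (R + T) := by
      gcongr; exact .var_legless rfl
    exact hred.elim (by rw [zero_add]; exact h T hT)
  · have hred : {spider .red k {a}} + (R + T) ⇝ᵥ[κ] R + ({spider .green (-k) {a}} + T) := calc
      _ ⇝ᵥ[κ] {spider .green (-k) {a}} + (R + T) := by gcongr; exact .state_odd hk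
      _ = _ := add_left_comm _ _ _
    exact hred.elim (h _ (.add (.phase (hN a (Multiset.mem_singleton_self a))) hT))
  · simp only [Multiset.mem_add, Multiset.mem_singleton, or_imp, forall_and, forall_eq] at hN
    obtain ⟨⟨ha, hb⟩, hN⟩ := hN
    obtain ⟨v, hv⟩ := Infinite.exists_notMem_finset (V ∪ R.points.toFinset)
    rw [Finset.mem_union, Multiset.mem_toFinset, not_or] at hv
    obtain ⟨hv, hR⟩ := hv
    refine .split_red (v := v) (fun h => hv (hN _ h)) ?_ (fun h => hv (h ▸ ha))
      (fun h => hv (h ▸ hb)) ?_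
    · rw [points_add, Multiset.mem_add, not_or]
      exact ⟨hR, hT.notMem_points hv⟩
    · have hred := red_odd (hT.mono (Finset.subset_insert v V)) (N := {v} + N)
        (R := {spider .red 0 ({a} + {b} + {v})} + R) hk
        (by simpa [or_imp, forall_and] using fun n hn => .inr (hN n hn))
        fun T hT => by rw [add_assoc]; exact hT.substitute hv ha hb hR h
      convert hred using 1
      ac_rfl
termination_by N.card

theorem red_of_ne (hT : GraphLike V T) (ha : a ∈ V) (hb : b ∈ V) (hN : ∀ n ∈ N, n ∈ V)
    (hab : a ≠ b) (haN : a ∉ N)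
    (h : ∀ v V', (∀ n ∈ {v} + N, n ∈ V') → V'.card = V.card →
      ∀ T, GraphLike V' T → VarReducible κ ({spider .red k ({v} + N)} + T)) :
    VarReducible κ ({spider .red k ({a} + {b} + N)} + T) := by
  obtain ⟨v, hv⟩ := Infinite.exists_notMem_finset V
  have hva : v ≠ a := fun h => hv (h ▸ ha)
  set V' := insert v (V.erase a)
  have hV' : V'.card = V.card := by
    rw [Finset.card_insert_of_notMem (mt Finset.mem_of_mem_erase hv), Finset.card_erase_add_one ha]
  have hNV' n (hn : n ∈ {v} + N) : n ∈ V' := by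
    rw [Multiset.mem_add, Multiset.mem_singleton] at hn
    exact Finset.mem_insert.2 (hn.imp_right fun hn =>
      Finset.mem_erase.2 ⟨ne_of_mem_of_not_mem hn haN, hN n hn⟩)
  have hTV' : GraphLike (insert a V') T := hT.mono fun w hw => by
    by_cases h : w = a <;> simp [V', h, hw]
  refine .split_red (v := v) (fun h => hv (hN _ h)) (hT.notMem_points hv) hva
    (fun h => hv (h ▸ hb)) ?_
  have hred := hTV'.substitute (R := {spider .red k ({v} + N)}) (by simp [V', hva.symm])
    (Finset.mem_insert_of_mem (Finset.mem_erase.2 ⟨hab.symm, hb⟩)) (Finset.mem_insert_self v _)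
    (by simp [hva.symm, haN]) (h v V' hNV' hV')
  convert hred using 1
  ac_rfl

theorem red_even {V : Finset ℕ} {N : Multiset ℕ} {T : Diagram κ} (hT : GraphLike V T)
    (hk : k = 0 ∨ k = 2) (hN : ∀ n ∈ N, n ∈ V)
    (h : ∀ V' : Finset ℕ, V'.card ≤ V.card → ∀ T, GraphLike V' T → VarReducible κ T) :
    VarReducible κ ({spider .red k N} + T) := by
  by_cases hNN : N.Nodup
  swap
  · simp only [Multiset.nodup_iff_ne_cons_cons, ← Multiset.singleton_add, ← add_assoc, ne_eq,
      not_forall, not_not] at hNN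
    obtain ⟨v, N, rfl⟩ := hNN
    have hred : {spider .red k ({v} + {v} + N)} + T ⇝ᵥ[κ] {spider .red k N} + T := by
      gcongr; exact .red_hopf
    exact hred.elim (red_even hT hk (fun n hn => hN n (Multiset.mem_add.2 (.inr hn))) h)
  obtain rfl | ⟨a, rfl⟩ | ⟨a, b, N, rfl⟩ := eq_zero_or_singleton_or_pair N
  · have hred : {spider .red k 0} + T ⇝ᵥ[κ] 0 + T := by
      gcongr; exact .var_legless rfl
    exact hred.elim (by rw [zero_add]; exact h V le_rfl T hT)
  · have ha := hN a (Multiset.mem_singleton_self a)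
    rw [← Finset.insert_erase ha] at hT
    exact hT.specialize (Finset.notMem_erase a V) hk (h _ Finset.card_erase_le)
  · simp only [Multiset.mem_add, Multiset.mem_singleton, or_imp, forall_and, forall_eq] at hN
    obtain ⟨⟨ha, hb⟩, hN⟩ := hN
    rw [add_assoc, Multiset.singleton_add, Multiset.nodup_cons, Multiset.mem_add,
      Multiset.mem_singleton, not_or] at hNN
    exact hT.red_of_ne ha hb hN hNN.1.1 hNN.1.2 fun v V' hNV' hV' T hT =>
      red_even hT hk hNV' (by rwa [hV'])
termination_by N.card

theorem varReducible (hT : GraphLike V T) : VarReducible κ T := by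
  induction hV : V.card using Nat.strong_induction_on generalizing V T with | _ _ ih
  subst hV
  obtain rfl | ⟨e, he⟩ := T.empty_or_exists_mem
  · exact .zero
  obtain ⟨v, hv, hvT⟩ : ∃ v ∈ V, v ∈ T.points := by
    obtain ⟨k, v, hv, rfl⟩ | ⟨v, hv, w, _, rfl⟩ := hT e he
    all_goals exact ⟨v, hv, Multiset.mem_bind.2 ⟨_, he, by simp⟩⟩
  rw [← Finset.insert_erase hv] at hT
  obtain ⟨k, A, W, hA, hW, hred⟩ := hT.isolate
  have hv' := Finset.notMem_erase v V
  refine .of_phase_zero hvT (hred.elim (.of_red (fun h => hv' (hA v h)) (hW.notMem_points hv') ?_))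
  have hlt := Finset.card_erase_lt_of_mem hv
  have hparity : ∀ k : ZMod 4, (k = 1 ∨ k = 3) ∨ k = 0 ∨ k = 2 := by decide
  obtain hk | hk := hparity k
  · simpa only [zero_add] using
      hW.red_odd (R := 0) hk hA fun T hT => by rw [zero_add]; exact ih _ hlt hT rfl
  · exact hW.red_even hk hA fun U hU T hT => ih _ (hU.trans_lt hlt) hT rfl

end GraphLike

end Elimination

section Spiders

variable {κ : Calculus} {k : ZMod 4} {A : Multiset ℕ} {U X : Diagram κ} {V : Finset ℕ}

theorem VarReducible.red_add (hX : ∀ V U, GraphLike V U → VarReducible κ (X + U))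
    (hU : GraphLike V U) : VarReducible κ ({spider .red k A} + X + U) := by
  obtain ⟨v, hv⟩ := Infinite.exists_notMem_finset (V ∪ A.toFinset ∪ X.points.toFinset)
  simp only [Finset.mem_union, Multiset.mem_toFinset, not_or] at hv
  obtain ⟨⟨hV, hA⟩, hXv⟩ := hv
  rw [add_assoc]
  refine .of_phase_add_fan hA ?_ ?_
  · rw [points_add, Multiset.mem_add, not_or]
    exact ⟨hXv, hU.notMem_points hV⟩
  · have hred := hX (insert v (V ∪ A.toFinset)) ({spider .green k {v}} + fan κ v A + U) <|
      .add (.add (.phase (by simp)) (.fan (by simp) fun a ha => by simp [ha]))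
        (hU.mono fun w hw => by simp [hw])
    convert hred using 1
    ac_rfl

theorem VarReducible.green_add {U : Diagram κ} {V : Finset ℕ} {A : Multiset ℕ}
    (hX : ∀ V U, GraphLike V U → VarReducible κ (X + U))
    (hU : GraphLike V U) : VarReducible κ ({spider .green k A} + X + U) := by
  obtain rfl | ⟨a, rfl⟩ | ⟨a, b, N, rfl⟩ := eq_zero_or_singleton_or_pair A
  · have hred : {spider .green k 0} + X + U ⇝ᵥ[κ] 0 + X + U := by
      gcongr; exact .var_legless rfl
    exact hred.elim (by rw [zero_add]; exact hX V U hU)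
  · have hred := hX (insert a V) ({spider .green k {a}} + U) <|
      .add (.phase (by simp)) (hU.mono (Finset.subset_insert a V))
    convert hred using 1
    ac_rfl
  · have hred : {spider .green k ({a} + {b} + N)} + X + U ⇝ᵥ[κ]
        {spider .red 0 ({a} + {b})} + ({spider .green k ({a} + N)} + X) + U := calc
      _ ⇝ᵥ[κ] {spider .green k ({a} + N)} + {spider .red 0 ({a} + {b})} + X + U := by
        gcongr; exact .split_green
      _ = _ := by ac_rfl
    exact hred.elim (.red_add (fun V U hU => green_add hX hU) hU)
termination_by A.card

theorem varReducible_add (X : Diagram κ) (hU : GraphLike V U) : VarReducible κ (X + U) := by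
  induction X using Multiset.induction generalizing V U with
  | empty => rw [zero_add]; exact hU.varReducible
  | cons e X ih =>
    rw [← Multiset.singleton_add]
    cases e with
    | spider c k A =>
      cases c with
      | green => exact .green_add (fun V U hU => ih hU) hU
      | red => exact .red_add (fun V U hU => ih hU) hU
    | had s =>
      induction s with | _ a b =>
      have hred := ih (V := insert a (insert b V)) (U := {had s(a, b)} + U) <|
        .add (.had (by simp) (by simp)) (hU.mono fun v hv => by simp [hv])
      convert hred using 1
      ac_rfl
    | star h =>
      have hred : {star h} + X + U ⇝ᵥ[κ] 0 + X + U := by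
        gcongr; exact .var_legless rfl
      exact hred.elim (by rw [zero_add]; exact ih hU)
    | edge s =>
      induction s with | _ a b =>
      have hred : {edge s(a, b)} + X + U ⇝ᵥ[κ] {spider .red 0 ({a} + {b})} + X + U := by
        gcongr; exact .var_edge
      exact hred.elim (.red_add (fun V U hU => ih hU) hU)

end Spiders

section Wires

variable {κ : Calculus} {c : Colour} {k : ZMod 4} {A B : Multiset ℕ} {D K : Diagram κ}
  {Q : Diagram κ → Prop}

/-- For every point `x` of `P`, a wire from `x` to the point with the name of the variable of `x`.
In this way every point of a diagram becomes a variable. -/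
def wires (κ : Calculus) (P : Multiset ℕ) : Diagram κ :=
  P.map fun x => spider .green 0 ({x} + {var x})

@[simp] theorem wires_add (P P' : Multiset ℕ) : wires κ (P + P') = wires κ P + wires κ P' :=
  Multiset.map_add _ _ _

@[simp] theorem wires_singleton (x : ℕ) : wires κ {x} = {spider .green 0 ({x} + {var x})} := rfl

theorem InContext.wire_legs (h : ∀ P, P.map var = A →
      InContext (Reducible κ) ({spider c k (P + B)} + wires κ P + K) Q) :
    InContext (Reducible κ) ({spider c k (A + B)} + K) Q := by
  induction A using Multiset.induction generalizing B K with
  | empty => simpa [wires] using h 0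
  | cons a A ih =>
    calc
      _ = {spider c k ({a} + (A + B))} + K := by rw [← Multiset.singleton_add, add_assoc]
      InContext (Reducible κ) _ Q := .unwire .green a fun x hx => calc
        _ = {spider c k (A + ({x} + B))} + (wires κ {x} + K) := by
          rw [wires_singleton, hx]
          ac_rfl
        InContext (Reducible κ) _ Q := ih fun P hP => calc
          _ = {spider c k ({x} + P + B)} + wires κ ({x} + P) + K := by
            rw [wires_add]
            ac_rfl
          InContext (Reducible κ) _ Q := h _ (by simp [hx, hP])

theorem InContext.wire_element (e : Element κ) (h : ∀ E : Diagram κ, E.map (rename var) = {e} →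
      InContext (Reducible κ) (E + wires κ E.points + K) Q) :
    InContext (Reducible κ) ({e} + K) Q := by
  cases e with
  | spider c k A => calc
      _ = {spider c k (A + 0)} + K := by rw [add_zero]
      InContext (Reducible κ) _ Q := .wire_legs fun P hP => calc
        _ = {spider c k P} + wires κ (Diagram.points ({spider c k P} : Diagram κ)) + K := by
          rw [add_zero, points_singleton, points_spider]
        InContext (Reducible κ) _ Q := h _ (by simp [rename, hP])
  | had s =>
    induction s with | _ a b =>
    calc
      InContext (Reducible κ) ({Element.had s(a, b)} + K) Q := .extend_had .green b fun y hy => calc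
        _ = {Element.had s(y, a)} + ({spider .green 0 ({y} + {b})} + K) := by
          rw [had_comm, add_assoc]
        InContext (Reducible κ) _ Q := .extend_had .green a fun x hx => calc
          _ = {Element.had s(y, x)} +
              wires κ (Diagram.points ({Element.had s(y, x)} : Diagram κ)) + K := by
            rw [points_singleton, points_had, wires_add, wires_singleton, wires_singleton, hx, hy]
            ac_rfl
          InContext (Reducible κ) _ Q := h _ (by simp [rename, hx, hy, Sym2.eq_swap])
  | star hκ => simpa [wires, Element.points] using h {star hκ} rfl
  | edge s =>
    induction s with | _ a b =>
    calc
      _ ⇝[κ] {spider .green 0 ({a} + {b} + 0)} + K := by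
        rw [add_zero]; gcongr; exact .edge .green
      InContext (Reducible κ) _ Q := .wire_legs fun P hP => by
        obtain ⟨x, P, rfl, hx, hP⟩ := exists_of_map_eq_singleton_add hP
        obtain ⟨y, rfl, hy⟩ := Multiset.map_eq_singleton.1 hP
        rw [add_zero]
        calc
          _ ⇝[κ] {Element.edge s(x, y)} + wires κ ({x} + {y}) + K := by
            gcongr ?_ + _ + _; exact .cup .green
          InContext (Reducible κ) _ Q := h _ (by simp [rename, hx, hy])

theorem InContext.wire_diagram (D : Diagram κ) (h : ∀ E : Diagram κ, E.map (rename var) = D →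
      InContext (Reducible κ) (E + wires κ E.points + K) Q) :
    InContext (Reducible κ) (D + K) Q := by
  induction D using Multiset.induction generalizing K with
  | empty => simpa [wires] using h 0 rfl
  | cons e D ih => calc
      _ = {e} + (D + K) := by rw [← Multiset.singleton_add, add_assoc]
      InContext (Reducible κ) _ Q := .wire_element e fun E hE => calc
        _ = D + (E + wires κ E.points + K) := add_left_comm _ _ _
        InContext (Reducible κ) _ Q := ih fun F hF => calc
          _ = E + F + wires κ (Diagram.points (E + F)) + K := by
            rw [points_add, wires_add]
            ac_rfl
          InContext (Reducible κ) _ Q := h _ (by rw [Multiset.map_add, hE, hF]; rfl)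

theorem ReducesTo.wires {P : Multiset ℕ}
    (hP : ∀ v, (P.map var).count v = 0 ∨ (P.map var).count v = 2) : wires κ P ⇝[κ] link κ P := by
  obtain rfl | ⟨x, hx⟩ := P.empty_or_exists_mem
  · rfl
  obtain ⟨P, rfl⟩ := Multiset.exists_cons_of_mem hx
  obtain ⟨y, hy, hyx⟩ : ∃ y ∈ P, var y = var x := by
    have hx := hP (var x)
    rw [Multiset.map_cons, Multiset.count_cons_self] at hx
    exact Multiset.mem_map.1 (Multiset.count_pos.1 (by omega))
  obtain ⟨P, rfl⟩ := Multiset.exists_cons_of_mem hy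
  simp only [← Multiset.singleton_add, ← add_assoc, Multiset.map_add, Multiset.map_singleton, hyx,
    Multiset.count_add] at hP ⊢
  have hxP : var x ∉ P.map var := by
    have hx := hP (var x)
    rw [Multiset.count_singleton_self] at hx
    exact Multiset.count_eq_zero.1 (by omega)
  have hP' v : (P.map var).count v = 0 ∨ (P.map var).count v = 2 := by
    by_cases hv : v = var x
    · exact .inl (by rwa [hv, Multiset.count_eq_zero])
    · simpa [Multiset.count_singleton, hv] using hP v
  calc
    _ = {spider .green 0 ({var x} + {x})} + {spider .green 0 ({var x} + {y})} + ZX.wires κ P := by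
      rw [wires_add, wires_add, wires_singleton, wires_singleton, hyx]
      ac_rfl
    _ ⇝[κ] {spider .green 0 ({x} + {y})} + link κ P := by
      gcongr
      · exact .merge_zero (var x)
      · exact wires hP'
    _ = link κ ({x} + {y} + P) := by
      exact (link_add_eq_of_notMem (by simp) (by simp [hyx]) hxP).symm
termination_by P.card

theorem VarReducible.reducible (h : VarReducible κ D) (hD : D.IsScalar) : Reducible κ D := by
  have hwires : InContext (Reducible κ) (D + 0) (· = 0) := .wire_diagram D fun E hE => by
    have hlink : E + wires κ E.points + 0 ⇝[κ] E + link κ E.points := by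
      rw [add_zero]
      gcongr
      exact .wires (by rwa [← Diagram.points_map_rename, hE])
    rintro _ rfl
    rw [add_zero]
    exact hlink.elim (h E hE)
  simpa using hwires 0 rfl

end Wires

end ZX

theorem corollary1 (κ : ZX.Calculus) (D : ZX.Diagram κ) (hD : D.IsScalar) :
    ∃ D' : ZX.Diagram κ, ZX.Rewrites κ D D' ∧ D'.IsDecomposed := by
  have hvar : ZX.VarReducible κ D := by simpa using ZX.varReducible_add D (V := ∅) .zero
  exact (hvar.reducible hD).exists_isDecomposed hD
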